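/- Let $\tilde d\ge d\ge 1$ be integers, let $\lambda_1\ge\dots\ge\lambda_{\tilde d}$ and $b_1,\dots,b_{\tilde d}$ be real numbers with $\lambda_d>0$ and, if $\tilde d>d$, $\lambda_d>\lambda_{d+1}$. Put $$A=\operatorname{diag}(\lambda_1,\dots,\lambda_d),\quad b=(b_1,\dots,b_d)^\top,\qquad \tilde A=\operatorname{diag}(\lambda_1,\dots,\lambda_{\tilde d}),\quad \tilde b=(b_1,\dots,b_{\tilde d})^\top .$$ For a symmetric matrix $M$ and a vector $c$, let $\mathcal K_n(M,c)=\operatorname{span}\{c,Mc,\dots,M^{n-1}c\}$. The grade of $(M,c)$ is the largest $n$ such that $\dim\mathcal K_n(M,c)=n$. The conjugate gradient method (CG) on $(M,c)$ is the recursion $v_0=0$, $r_0=u_0=c$, $$\alpha_n=\frac{\|r_{n-1}\|^2}{\langle u_{n-1},Mu_{n-1}\rangle},\quad v_n=v_{n-1}+\alpha_nu_{n-1},\quad r_n=r_{n-1}-\alpha_nMu_{n-1},\quad \beta_n=\frac{\|r_n\|^2}{\|r_{n-1}\|^2},\quad u_n=r_n+\beta_nu_{n-1}.$$ Its $n$th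 iteration is well defined if $n$ is at most the grade of $(M,c)$ and $\langle x,Mx\rangle>0$ for all nonzero $x\in\mathcal K_n(M,c)$. Let $\ell$ be the grade of $(A,b)$ and let $n\in\{1,\dots,\ell\}$. For a real polynomial $p$ let $\|p\|^2=\sum_{i=1}^d b_i^2\,p(\lambda_i)^2$. Let $\pi_n$ be the minimizer of $\|\pi\|^2$ over the polynomials $\pi$ of degree at most $n$ whose coefficient of degree $n$ is $1$, and let $\varsigma_n=\pi_n/\pi_n(0)$. For $j\in\{d+1,\dots,\tilde d\}$ let $\zeta^j_{n-1}$ be the minimizer of $\|\zeta\|^2$ over the polynomials $\zeta$ of degree at most $n-1$ with $\zeta(\lambda_j)=1$, and let $\xi^j_{n-1}=\zeta^j_{n-1}/\zeta^j_{n-1}(0)$. With indices $i,j$ running over $\{d+1,\dots,\tilde d\}$, let $$B=\operatorname{diag}(b_j)_j,\qquad C_{ij}=\xi^j_{n-1}(\lambda_i),\qquad D=\operatorname{diag}\!\left(\frac{\|\xi^j_{n-1}\|^2}{\xi^j_{n-1}(\lambda_j)}\right)_{\!j},\qquad w=\big(\varsigma_n(\lambda_j)\big)_j,\qquad \sigma=(D+B^2C)^{-1}B^2w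 .$$ Suppose that $\|\sigma\|_1=\sum_j|\sigma_j|<1$. Then the $n$th iterations of CG on $(A,b)$ and on $(\tilde A,\tilde b)$ are well defined, and the $n$th iterates $v$ of CG on $(A,b)$ and $\tilde v$ of CG on $(\tilde A,\tilde b)$ satisfy $$\|\tilde v_{1:d}-v\|\le\frac{\|\sigma\|_1}{1-\|\sigma\|_1}\,\|v\|,$$ where $\tilde v_{1:d}$ consists of the first $d$ entries of $\tilde v$ and the norm is Euclidean, and, for all $i\in\{d+1,\dots,\tilde d\}$, $$|\tilde v_i|\le\frac{|b_i|}{1-\|\sigma\|_1}\,\left|\frac{(1-\lambda_i/\lambda_d)^n-1}{\lambda_i}\right|,$$ where the last absolute value is read as its limit $n/\lambda_d$ when $\lambda_i=0$. -/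

import Mathlib

open Polynomial

noncomputable section

namespace CGIndef

/-- The state of the conjugate gradient method: iterate `v`, residual `r`, search direction `u`. -/
structure CGState (E : Type*) where
  v : E
  r : E
  u : E

section ConjugateGradient

variable {E : Type*} [NormedAddCommGroup E] [InnerProductSpace ℝ E]

/-- One step of the (untruncated) conjugate gradient method on the system `A x = b`:
`α = ‖r‖² / ⟨u, A u⟩`, `v⁺ = v + α u`, `r⁺ = r - α A u`, `β = ‖r⁺‖² / ‖r‖²`,
`u⁺ = r⁺ + β u`. -/
def cgStep (A : E →ₗ[ℝ] E) (s : CGState E) : CGState E :=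
  let α : ℝ := ‖s.r‖ ^ 2 / inner ℝ s.u (A s.u)
  let r' : E := s.r - α • A s.u
  let β : ℝ := ‖r'‖ ^ 2 / ‖s.r‖ ^ 2
  { v := s.v + α • s.u, r := r', u := r' + β • s.u }

/-- The state after `n` steps, started from `v₀ = 0`, `r₀ = u₀ = b`. -/
def cgState (A : E →ₗ[ℝ] E) (b : E) : ℕ → CGState E
  | 0 => { v := 0, r := b, u := b }
  | n + 1 => cgStep A (cgState A b n)

/-- The `n`th iterate of the conjugate gradient method on `(A, b)`. -/
def cgIterate (A : E →ₗ[ℝ] E) (b : E) (n : ℕ) : E := (cgState A b n).v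

/-- The `n`th Krylov subspace, spanned by `b, A b, …, A ^ (n - 1) b`. -/
def krylov (A : E →ₗ[ℝ] E) (b : E) (n : ℕ) : Submodule ℝ E :=
  Submodule.span ℝ (Set.range fun k : Fin n => (A ^ (k : ℕ)) b)

/-- The grade of `(A, b)`: the largest `n` such that the `n`th Krylov subspace has dimension `n`
(in a finite-dimensional space the set below is bounded, and it contains `0`). -/
def grade (A : E →ₗ[ℝ] E) (b : E) : ℕ :=
  sSup {n : ℕ | Module.finrank ℝ (krylov A b n) = n}

/-- The `n`th iteration of the conjugate gradient method on `(A, b)` is well defined: `n` is at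
most the grade, and `A` is positive definite on the `n`th Krylov subspace. -/
def CGWellDefined (A : E →ₗ[ℝ] E) (b : E) (n : ℕ) : Prop :=
  n ≤ grade A b ∧ ∀ x ∈ krylov A b n, x ≠ 0 → 0 < inner ℝ x (A x)

end ConjugateGradient

/-- The diagonal matrix `diag (lam)`, acting on Euclidean space. -/
def diagOp {N : ℕ} (lam : Fin N → ℝ) :
    EuclideanSpace ℝ (Fin N) →ₗ[ℝ] EuclideanSpace ℝ (Fin N) :=
  Matrix.toEuclideanLin (Matrix.diagonal lam)

section Polynomials

variable {d : ℕ}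

/-- The squared semi-norm `‖p‖² = ∑ᵢ bᵢ² p(λᵢ)²` on polynomials. -/
def polyNormSq (lam b : Fin d → ℝ) (p : ℝ[X]) : ℝ :=
  ∑ i, b i ^ 2 * p.eval (lam i) ^ 2

/-- `p` minimizes the semi-norm among the polynomials of degree at most `n` whose coefficient of
degree `n` is `1`. -/
def IsLanczos (lam b : Fin d → ℝ) (n : ℕ) (p : ℝ[X]) : Prop :=
  p.natDegree ≤ n ∧ p.coeff n = 1 ∧
    ∀ q : ℝ[X], q.natDegree ≤ n → q.coeff n = 1 → polyNormSq lam b p ≤ polyNormSq lam b q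

/-- The `n`th Lanczos polynomial `πₙ` of `(diag lam, b)`. A minimizer always exists, and it is
unique when `n` is at most the grade. -/
def lanczos (lam b : Fin d → ℝ) (n : ℕ) : ℝ[X] :=
  Classical.epsilon (IsLanczos lam b n)

/-- The rescaled Lanczos polynomial `ςₙ = πₙ / πₙ(0)`. -/
def varsigma (lam b : Fin d → ℝ) (n : ℕ) : ℝ[X] :=
  C ((lanczos lam b n).eval 0)⁻¹ * lanczos lam b n

/-- `p` minimizes the semi-norm among the polynomials of degree at most `n` with value `1`
at `x`. -/
def IsZeta (lam b : Fin d → ℝ) (x : ℝ) (n : ℕ) (p : ℝ[X]) : Prop :=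
  p.natDegree ≤ n ∧ p.eval x = 1 ∧
    ∀ q : ℝ[X], q.natDegree ≤ n → q.eval x = 1 → polyNormSq lam b p ≤ polyNormSq lam b q

/-- The polynomial `ζₙ` of `(diag lam, b)` relative to the point `x`. A minimizer always exists,
and it is unique when `n` is less than the grade. -/
def zeta (lam b : Fin d → ℝ) (x : ℝ) (n : ℕ) : ℝ[X] :=
  Classical.epsilon (IsZeta lam b x n)

/-- The rescaled polynomial `ξₙ = ζₙ / ζₙ(0)`. -/
def xi (lam b : Fin d → ℝ) (x : ℝ) (n : ℕ) : ℝ[X] :=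
  C ((zeta lam b x n).eval 0)⁻¹ * zeta lam b x n

end Polynomials

section Perturbation

variable {d m : ℕ}

/-- The first `d` entries of a vector of size `d + m`. -/
def head (x : Fin (d + m) → ℝ) : Fin d → ℝ := fun i => x (Fin.castAdd m i)

/-- The last `m` entries of a vector of size `d + m`. -/
def tail (x : Fin (d + m) → ℝ) : Fin m → ℝ := fun j => x (Fin.natAdd d j)

/-- `B = diag (b_{d+1}, …, b_{d+m})`. -/
def matB (b : Fin (d + m) → ℝ) : Matrix (Fin m) (Fin m) ℝ :=
  Matrix.diagonal (tail b)

/-- `C_{ij} = ξ_{n-1}^j (λ_i)`, where `ξ^j` is relative to the point `λ_j`. -/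
def matC (lam b : Fin (d + m) → ℝ) (n : ℕ) : Matrix (Fin m) (Fin m) ℝ :=
  Matrix.of fun i j => (xi (head lam) (head b) (tail lam j) (n - 1)).eval (tail lam i)

/-- `D = diag (‖ξ_{n-1}^j‖² / ξ_{n-1}^j (λ_j))`. -/
def matD (lam b : Fin (d + m) → ℝ) (n : ℕ) : Matrix (Fin m) (Fin m) ℝ :=
  Matrix.diagonal fun j =>
    polyNormSq (head lam) (head b) (xi (head lam) (head b) (tail lam j) (n - 1)) /
      (xi (head lam) (head b) (tail lam j) (n - 1)).eval (tail lam j)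

/-- `w_j = ςₙ (λ_j)`. -/
def vecW (lam b : Fin (d + m) → ℝ) (n : ℕ) : Fin m → ℝ :=
  fun j => (varsigma (head lam) (head b) n).eval (tail lam j)

/-- `σ = (D + B² C)⁻¹ B² w`. -/
def sigma (lam b : Fin (d + m) → ℝ) (n : ℕ) : Fin m → ℝ :=
  Matrix.mulVec (matD lam b n + matB b ^ 2 * matC lam b n)⁻¹
    (Matrix.mulVec (matB b ^ 2) (vecW lam b n))

/-- `‖σ‖₁`. -/
def sigmaNorm (lam b : Fin (d + m) → ℝ) (n : ℕ) : ℝ := ∑ j, |sigma lam b n j|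

/-- `|((1 - x / l) ^ n - 1) / x|`, extended by its limit `n / l` at `x = 0`. -/
def tailBound (l x : ℝ) (n : ℕ) : ℝ :=
  if x = 0 then n / l else |((1 - x / l) ^ n - 1) / x|

end Perturbation

end CGIndef

end

/-! A Krylov vector `p(A) b` is encoded by the polynomial `p`; the grade is at least `n` exactly
when this encoding is injective in degree `< n`. Under positive definiteness the CG iterate is the
only `q` of degree `< n` whose residual `1 - X q` is orthogonal to all polynomials of degree `< n`
(`cgIterate_eq_polyVec`).

For `(A, b)` let `rₖ = 1 - X vₖ` be the residual polynomials. Their roots are at least `λ_d`, so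
below `λ_d` each `rₖ` is positive and `vₖ` increases with `k`. The reproducing kernel at `λ_j` is
therefore a combination of `r₀, …, rₙ₋₁` with positive coefficients. Normalized at `0` it is `ξ^j`
(`xi_eq`), so `ξ^j = 1 - X h_j` with `h_j` a convex combination of `v₀, …, vₙ₋₁`.

The linear system for `σ` makes `rₙ - ∑ σ_j ξ^j` orthogonal to degree `< n` for the extended inner
product (`extResidual_orth`). On `(-∞, 0]` one has `|ξ^j| ≤ rₙ`, so `‖σ‖₁ < 1` keeps this polynomial
positive there (`extResidual_eval_pos`). The Ritz values of the extended operator are among its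
roots, hence positive, and CG is well defined (`inner_pos_of_no_root`).

Normalizing at `0` gives the extended iterate, which differs from `vₙ` by `(1 - ∑ σ_j)⁻¹ ∑ σ_j (vₙ -
h_j)` (`extIterate_sub_eq`). The head bound follows from `‖vₙ - vₖ‖ ≤ ‖vₙ‖`, valid because CG
directions have nonnegative inner products (`norm_iterate_sub_le`). The tail bound follows from `0 ≤
vₙ - h_j ≤ vₙ` below `λ_d`, together with moving all roots of `rₙ` to `λ_d` (`eval_le_tailBound`).
-/

noncomputable section

namespace CGIndef

/-! ### Krylov vectors as polynomials, and the grade. -/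

section Krylov

variable {E : Type*} [NormedAddCommGroup E] [InnerProductSpace ℝ E]

/-- The vector `p(A) b`, linearly in the polynomial `p`. -/
def polyVec (A : E →ₗ[ℝ] E) (b : E) : ℝ[X] →ₗ[ℝ] E :=
  (LinearMap.applyₗ b).comp (aeval A).toLinearMap

theorem polyVec_apply (A : E →ₗ[ℝ] E) (b : E) (p : ℝ[X]) : polyVec A b p = aeval A p b := rfl

@[simp] theorem polyVec_one (A : E →ₗ[ℝ] E) (b : E) : polyVec A b 1 = b := by
  simp [polyVec_apply]

theorem polyVec_X_mul (A : E →ₗ[ℝ] E) (b : E) (p : ℝ[X]) :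
    polyVec A b (X * p) = A (polyVec A b p) := by
  simp [polyVec_apply, Module.End.mul_apply]

theorem polyVec_C_mul (A : E →ₗ[ℝ] E) (b : E) (c : ℝ) (p : ℝ[X]) :
    polyVec A b (C c * p) = c • polyVec A b p := by
  rw [← smul_eq_C_mul, map_smul]

theorem krylov_eq_map (A : E →ₗ[ℝ] E) (b : E) (n : ℕ) :
    krylov A b n = (degreeLT ℝ n).map (polyVec A b) := by
  classical
  rw [degreeLT_eq_span_X_pow, Submodule.map_span, krylov]
  congr 1
  ext x
  simp only [Set.mem_range, Finset.coe_image, Set.mem_image, Finset.coe_range, Set.mem_Iio]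
  constructor
  · rintro ⟨k, rfl⟩
    exact ⟨X ^ (k : ℕ), ⟨k, k.2, rfl⟩, by simp [polyVec_apply]⟩
  · rintro ⟨_, ⟨k, hk, rfl⟩, rfl⟩
    exact ⟨⟨k, hk⟩, by simp [polyVec_apply]⟩

theorem mem_krylov {A : E →ₗ[ℝ] E} {b : E} {n : ℕ} {x : E} :
    x ∈ krylov A b n ↔ ∃ p : ℝ[X], p.degree < n ∧ polyVec A b p = x := by
  simp [krylov_eq_map, mem_degreeLT]

/-- Rank-nullity for `p ↦ p(A) b` on the `n`-dimensional space of polynomials of degree `< n`. -/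
theorem finrank_krylov_eq_iff (A : E →ₗ[ℝ] E) (b : E) (n : ℕ) :
    Module.finrank ℝ (krylov A b n) = n ↔
      ∀ p : ℝ[X], p.degree < n → polyVec A b p = 0 → p = 0 := by
  have hfin : Module.finrank ℝ (degreeLT ℝ n) = n := by
    rw [(degreeLTEquiv ℝ n).finrank_eq, Module.finrank_fin_fun]
  have : Module.Finite ℝ (degreeLT ℝ n) := Module.Finite.equiv (degreeLTEquiv ℝ n).symm
  set f := (polyVec A b).domRestrict (degreeLT ℝ n)
  have hrange : krylov A b n = LinearMap.range f := by
    rw [krylov_eq_map, LinearMap.range_domRestrict]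
  have hsum := LinearMap.finrank_range_add_finrank_ker f
  rw [hfin, ← hrange] at hsum
  have h1 : Module.finrank ℝ (krylov A b n) = n ↔ Module.finrank ℝ (LinearMap.ker f) = 0 := by
    omega
  rw [h1, Submodule.finrank_eq_zero, LinearMap.ker_eq_bot']
  constructor
  · intro h p hp h0
    exact congrArg Subtype.val (h ⟨p, mem_degreeLT.2 hp⟩ h0)
  · rintro h ⟨p, hp⟩ h0
    exact Subtype.ext (h p (mem_degreeLT.1 hp) h0)

/-- The supremum is attained, and injectivity in degree `< grade` restricts to every smaller degree.
-/
theorem le_grade_iff [FiniteDimensional ℝ E] (A : E →ₗ[ℝ] E) (b : E) (n : ℕ) :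
    n ≤ grade A b ↔ ∀ p : ℝ[X], p.degree < n → polyVec A b p = 0 → p = 0 := by
  have hbdd : BddAbove {n : ℕ | Module.finrank ℝ (krylov A b n) = n} := by
    refine ⟨Module.finrank ℝ E, fun k hk => ?_⟩
    rw [← (show _ = k from hk)]
    exact Submodule.finrank_le _
  have hne : {n : ℕ | Module.finrank ℝ (krylov A b n) = n}.Nonempty := by
    refine ⟨0, (finrank_krylov_eq_iff A b 0).2 fun p hp _ => ?_⟩
    simpa using hp
  constructor
  · intro hn p hp
    exact (finrank_krylov_eq_iff A b _).1 (Nat.sSup_mem hne hbdd) p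
      (hp.trans_le (by exact_mod_cast hn))
  · intro h
    exact le_csSup hbdd ((finrank_krylov_eq_iff A b n).2 h)

end Krylov

/-! ### The CG recursion on polynomials. -/

section PolynomialRecursion

variable {E : Type*} [NormedAddCommGroup E] [InnerProductSpace ℝ E]

/-- The step length of the conjugate gradient method. -/
def cgAlpha (A : E →ₗ[ℝ] E) (b : E) (k : ℕ) : ℝ :=
  ‖(cgState A b k).r‖ ^ 2 / inner ℝ (cgState A b k).u (A (cgState A b k).u)

/-- The coefficient of the direction update of the conjugate gradient method. -/
def cgBeta (A : E →ₗ[ℝ] E) (b : E) (k : ℕ) : ℝ :=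
  ‖(cgState A b (k + 1)).r‖ ^ 2 / ‖(cgState A b k).r‖ ^ 2

/-- The polynomials whose values at `A`, applied to `b`, are the state of the conjugate gradient
method. -/
def cgPoly (A : E →ₗ[ℝ] E) (b : E) : ℕ → CGState ℝ[X]
  | 0 => { v := 0, r := 1, u := 1 }
  | k + 1 =>
    let s := cgPoly A b k
    { v := s.v + C (cgAlpha A b k) * s.u
      r := s.r - C (cgAlpha A b k) * (X * s.u)
      u := s.r - C (cgAlpha A b k) * (X * s.u) + C (cgBeta A b k) * s.u }

variable (A : E →ₗ[ℝ] E) (b : E)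

theorem cgState_v_succ (k : ℕ) :
    (cgState A b (k + 1)).v = (cgState A b k).v + cgAlpha A b k • (cgState A b k).u := rfl

theorem cgState_r_succ (k : ℕ) :
    (cgState A b (k + 1)).r = (cgState A b k).r - cgAlpha A b k • A (cgState A b k).u := rfl

theorem cgState_u_succ (k : ℕ) :
    (cgState A b (k + 1)).u = (cgState A b (k + 1)).r + cgBeta A b k • (cgState A b k).u := rfl

theorem cgPoly_v_succ (k : ℕ) :
    (cgPoly A b (k + 1)).v = (cgPoly A b k).v + C (cgAlpha A b k) * (cgPoly A b k).u := rfl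

theorem cgPoly_r_succ (k : ℕ) :
    (cgPoly A b (k + 1)).r = (cgPoly A b k).r - C (cgAlpha A b k) * (X * (cgPoly A b k).u) := rfl

theorem cgPoly_u_succ (k : ℕ) :
    (cgPoly A b (k + 1)).u = (cgPoly A b (k + 1)).r + C (cgBeta A b k) * (cgPoly A b k).u := rfl

theorem polyVec_cgPoly (k : ℕ) :
    polyVec A b (cgPoly A b k).v = (cgState A b k).v ∧
      polyVec A b (cgPoly A b k).r = (cgState A b k).r ∧
      polyVec A b (cgPoly A b k).u = (cgState A b k).u := by
  induction k with
  | zero => simp [cgPoly, cgState]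
  | succ k ih =>
    obtain ⟨h1, h2, h3⟩ := ih
    have hr : polyVec A b (cgPoly A b (k + 1)).r = (cgState A b (k + 1)).r := by
      rw [cgPoly_r_succ, map_sub, polyVec_C_mul, polyVec_X_mul, h2, h3, cgState_r_succ]
    refine ⟨?_, hr, ?_⟩
    · rw [cgPoly_v_succ, map_add, polyVec_C_mul, h1, h3, cgState_v_succ]
    · rw [cgPoly_u_succ, map_add, polyVec_C_mul, hr, h3, cgState_u_succ]

theorem polyVec_cgPoly_v (k : ℕ) : polyVec A b (cgPoly A b k).v = (cgState A b k).v :=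
  (polyVec_cgPoly A b k).1

theorem polyVec_cgPoly_r (k : ℕ) : polyVec A b (cgPoly A b k).r = (cgState A b k).r :=
  (polyVec_cgPoly A b k).2.1

theorem polyVec_cgPoly_u (k : ℕ) : polyVec A b (cgPoly A b k).u = (cgState A b k).u :=
  (polyVec_cgPoly A b k).2.2

theorem cgPoly_r_eq (k : ℕ) : (cgPoly A b k).r = 1 - X * (cgPoly A b k).v := by
  induction k with
  | zero => simp [cgPoly]
  | succ k ih => rw [cgPoly_r_succ, cgPoly_v_succ, ih]; ring

theorem cgPoly_r_eval_zero (k : ℕ) : (cgPoly A b k).r.eval 0 = 1 := by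
  simp [cgPoly_r_eq]

theorem cgBeta_nonneg (k : ℕ) : 0 ≤ cgBeta A b k := by
  unfold cgBeta; positivity

end PolynomialRecursion

/-! ### Orthogonality and conjugacy in CG, and monotonicity of the iterates. -/

section Orthogonality

variable {E : Type*} [NormedAddCommGroup E] [InnerProductSpace ℝ E]

theorem degree_X_mul_lt {p : ℝ[X]} {k : ℕ} (hp : p.degree < k) :
    (X * p).degree < ((k + 1 : ℕ) : WithBot ℕ) := by
  by_cases h0 : p = 0
  · simp only [h0, mul_zero, degree_zero]; exact WithBot.bot_lt_coe _
  · rw [degree_eq_natDegree h0] at hp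
    rw [degree_mul, degree_X, degree_eq_natDegree h0]
    have : p.natDegree < k := by exact_mod_cast hp
    exact_mod_cast (by omega : 1 + p.natDegree < k + 1)

theorem exists_eq_C_mul_add {p q : ℝ[X]} {k : ℕ} (hq : q.degree = k) (hp : p.degree < (k + 1 : ℕ)) :
    ∃ (c : ℝ) (p' : ℝ[X]), p'.degree < k ∧ p = C c * q + p' := by
  have hq0 : q.coeff k ≠ 0 := coeff_ne_zero_of_eq_degree hq
  refine ⟨p.coeff k / q.coeff k, p - C (p.coeff k / q.coeff k) * q, ?_, by ring⟩
  rw [degree_lt_iff_coeff_zero]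
  intro m hm
  rcases hm.eq_or_lt with rfl | hm
  · simp [hq0]
  · have h1 : p.coeff m = 0 :=
      coeff_eq_zero_of_degree_lt (hp.trans_le (by exact_mod_cast hm))
    have h2 : q.coeff m = 0 :=
      coeff_eq_zero_of_degree_lt (by rw [hq]; exact_mod_cast hm)
    simp [h1, h2]

/-- The invariants of the conjugate gradient method after `k` steps. -/
structure CGInvariant (A : E →ₗ[ℝ] E) (b : E) (k : ℕ) : Prop where
  degree_r : (cgPoly A b k).r.degree = k
  degree_u : (cgPoly A b k).u.degree = k
  degree_sub : ((cgPoly A b k).u - (cgPoly A b k).r).degree < k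
  degree_v : (cgPoly A b k).v.degree < k
  orth : ∀ q : ℝ[X], q.degree < k → inner ℝ (cgState A b k).r (polyVec A b q) = 0
  conj : ∀ q : ℝ[X], q.degree < k → inner ℝ (A (cgState A b k).u) (polyVec A b q) = 0

variable {A : E →ₗ[ℝ] E} {b : E} {n : ℕ}

/-- `p(A) b ≠ 0` for all nonzero polynomials `p` of degree less than `n`. -/
def GradeGE (A : E →ₗ[ℝ] E) (b : E) (n : ℕ) : Prop :=
  ∀ p : ℝ[X], p.degree < n → polyVec A b p = 0 → p = 0

theorem CGInvariant.r_ne_zero {k : ℕ} (h : CGInvariant A b k) (hg : GradeGE A b n) (hk : k < n) :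
    (cgState A b k).r ≠ 0 := by
  intro h0
  rw [← polyVec_cgPoly_r] at h0
  have := hg _ (by rw [h.degree_r]; exact_mod_cast hk) h0
  have h1 := h.degree_r
  rw [this] at h1
  simp at h1

theorem CGInvariant.u_ne_zero {k : ℕ} (h : CGInvariant A b k) (hg : GradeGE A b n) (hk : k < n) :
    (cgState A b k).u ≠ 0 := by
  intro h0
  rw [← polyVec_cgPoly_u] at h0
  have := hg _ (by rw [h.degree_u]; exact_mod_cast hk) h0
  have h1 := h.degree_u
  rw [this] at h1
  simp at h1

theorem CGInvariant.inner_pos {k : ℕ} (h : CGInvariant A b k) (hg : GradeGE A b n)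
    (hpd : ∀ x ∈ krylov A b n, x ≠ 0 → 0 < inner ℝ x (A x)) (hk : k < n) :
    0 < inner ℝ (cgState A b k).u (A (cgState A b k).u) := by
  refine hpd _ (mem_krylov.2 ⟨_, ?_, polyVec_cgPoly_u A b k⟩) (h.u_ne_zero hg hk)
  rw [h.degree_u]
  exact_mod_cast hk

theorem CGInvariant.alpha_pos {k : ℕ} (h : CGInvariant A b k) (hg : GradeGE A b n)
    (hpd : ∀ x ∈ krylov A b n, x ≠ 0 → 0 < inner ℝ x (A x)) (hk : k < n) :
    0 < cgAlpha A b k := by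
  have := h.r_ne_zero hg hk
  have := h.inner_pos hg hpd hk
  unfold cgAlpha
  positivity

/-- A test polynomial of degree at most `k` is a multiple of `uₖ` plus one of lower degree. The
lower part is handled by the previous invariants; `α` and `β` are the values that annihilate the
`uₖ` part for the residual and for the direction. -/
theorem CGInvariant.succ {k : ℕ} (h : CGInvariant A b k) (hA : A.IsSymmetric) (hg : GradeGE A b n)
    (hpd : ∀ x ∈ krylov A b n, x ≠ 0 → 0 < inner ℝ x (A x)) (hk : k < n) :
    CGInvariant A b (k + 1) := by
  have hr := h.r_ne_zero hg hk
  have hu := h.inner_pos hg hpd hk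
  have ha := h.alpha_pos hg hpd hk
  have hkk : (k : WithBot ℕ) < (k + 1 : ℕ) := by exact_mod_cast k.lt_succ_self
  have hdXu : (C (cgAlpha A b k) * (X * (cgPoly A b k).u)).degree = ((k + 1 : ℕ) : WithBot ℕ) := by
    rw [degree_C_mul ha.ne', degree_mul, degree_X, h.degree_u, add_comm]; rfl
  have hdr : (cgPoly A b (k + 1)).r.degree = ((k + 1 : ℕ) : WithBot ℕ) := by
    rw [cgPoly_r_succ, degree_sub_eq_right_of_degree_lt, hdXu]
    rw [hdXu, h.degree_r]; exact hkk
  have hdbu : (C (cgBeta A b k) * (cgPoly A b k).u).degree < (k + 1 : ℕ) := by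
    refine lt_of_le_of_lt ?_ hkk
    rw [← h.degree_u]
    rw [← smul_eq_C_mul]
    exact degree_smul_le _ _
  have horth : ∀ q : ℝ[X], q.degree < (k + 1 : ℕ) →
      inner ℝ (cgState A b (k + 1)).r (polyVec A b q) = 0 := by
    intro q hq
    obtain ⟨c, q', hq', rfl⟩ := exists_eq_C_mul_add h.degree_u hq
    -- `uₖ - rₖ` has degree `< k`, hence is orthogonal to `rₖ`.
    have hru : inner ℝ (cgState A b k).r (cgState A b k).u = ‖(cgState A b k).r‖ ^ 2 := by
      have := h.orth _ h.degree_sub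
      rw [map_sub, polyVec_cgPoly_u, polyVec_cgPoly_r, inner_sub_right,
        real_inner_self_eq_norm_sq] at this
      linarith
    have hau : cgAlpha A b k * inner ℝ (A (cgState A b k).u) (cgState A b k).u
        = ‖(cgState A b k).r‖ ^ 2 := by
      rw [cgAlpha, real_inner_comm (cgState A b k).u, div_mul_cancel₀ _ hu.ne']
    rw [map_add, polyVec_C_mul, polyVec_cgPoly_u, inner_add_right, inner_smul_right,
      cgState_r_succ, inner_sub_left, inner_sub_left, inner_smul_left, inner_smul_left,
      h.orth _ hq', h.conj _ hq', hru]
    simp [hau]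
  refine ⟨hdr, ?_, ?_, ?_, horth, ?_⟩
  · rw [cgPoly_u_succ, degree_add_eq_left_of_degree_lt, hdr]
    rwa [hdr]
  · rw [cgPoly_u_succ, add_sub_cancel_left]
    exact hdbu
  · rw [cgPoly_v_succ]
    refine (degree_add_le _ _).trans_lt (max_lt (h.degree_v.trans hkk) ?_)
    rw [degree_C_mul ha.ne', h.degree_u]
    exact hkk
  · intro q hq
    obtain ⟨c, q', hq', rfl⟩ := exists_eq_C_mul_add h.degree_u hq
    have h1 : inner ℝ (A (cgState A b (k + 1)).u) (polyVec A b q') = 0 := by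
      have := horth _ (degree_X_mul_lt hq')
      rw [polyVec_X_mul] at this
      rw [cgState_u_succ, map_add, map_smul, inner_add_left, inner_smul_left, h.conj _ hq',
        hA, this]
      simp
    have h2 : inner ℝ (A (cgState A b (k + 1)).u) (cgState A b k).u = 0 := by
      have h3 : inner ℝ (cgState A b (k + 1)).r (cgState A b k).r = 0 := by
        rw [← polyVec_cgPoly_r A b k]
        exact horth _ (by rw [h.degree_r]; exact hkk)
      -- Multiplied by `αₖ`, the vector `A uₖ` becomes a difference of consecutive residuals, which
      -- are orthogonal to each other.
      have h4 : cgAlpha A b k • A (cgState A b k).u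
          = (cgState A b k).r - (cgState A b (k + 1)).r := by
        rw [cgState_r_succ]; abel
      have h5 : cgAlpha A b k * inner ℝ (cgState A b (k + 1)).r (A (cgState A b k).u)
          = - ‖(cgState A b (k + 1)).r‖ ^ 2 := by
        rw [← inner_smul_right, h4, inner_sub_right, h3, real_inner_self_eq_norm_sq]; ring
      have h6 : cgAlpha A b k * inner ℝ (cgState A b k).u (A (cgState A b k).u)
          = ‖(cgState A b k).r‖ ^ 2 := by
        rw [cgAlpha, div_mul_cancel₀ _ hu.ne']
      have h7 : cgBeta A b k * ‖(cgState A b k).r‖ ^ 2 = ‖(cgState A b (k + 1)).r‖ ^ 2 := by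
        rw [cgBeta, div_mul_cancel₀]
        positivity
      rw [hA, cgState_u_succ, inner_add_left, inner_smul_left]
      refine (mul_eq_zero.1 ?_).resolve_left ha.ne'
      simp only [conj_trivial]
      linear_combination h5 + cgBeta A b k * h6 + h7
    rw [map_add, polyVec_C_mul, polyVec_cgPoly_u, inner_add_right, inner_smul_right, h1, h2]
    simp

theorem cgInvariant (hA : A.IsSymmetric) (hg : GradeGE A b n)
    (hpd : ∀ x ∈ krylov A b n, x ≠ 0 → 0 < inner ℝ x (A x)) {k : ℕ} (hk : k ≤ n) :
    CGInvariant A b k := by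
  induction k with
  | zero =>
    refine ⟨by simp [cgPoly], by simp [cgPoly], by simp [cgPoly], by simp [cgPoly], ?_, ?_⟩ <;>
    · intro q hq
      have : q = 0 := by simpa using hq
      simp [this]
  | succ k ih => exact (ih (by omega)).succ hA hg hpd hk

theorem cgAlpha_pos (hA : A.IsSymmetric) (hg : GradeGE A b n)
    (hpd : ∀ x ∈ krylov A b n, x ≠ 0 → 0 < inner ℝ x (A x)) {k : ℕ} (hk : k < n) :
    0 < cgAlpha A b k :=
  (cgInvariant hA hg hpd hk.le).alpha_pos hg hpd hk

/-- The iterate is the only vector of the Krylov space with residual orthogonal to that space. -/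
theorem cgIterate_eq_polyVec (hA : A.IsSymmetric) (hg : GradeGE A b n)
    (hpd : ∀ x ∈ krylov A b n, x ≠ 0 → 0 < inner ℝ x (A x)) {q : ℝ[X]} (hq : q.degree < n)
    (horth : ∀ p : ℝ[X], p.degree < n →
      inner ℝ (polyVec A b (1 - X * q)) (polyVec A b p) = 0) :
    cgIterate A b n = polyVec A b q := by
  have h := cgInvariant hA hg hpd le_rfl
  rw [cgIterate, ← polyVec_cgPoly_v, ← sub_eq_zero, ← map_sub]
  by_contra hne
  have hdeg : ((cgPoly A b n).v - q).degree < n :=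
    (degree_sub_le _ _).trans_lt (max_lt h.degree_v hq)
  -- For the difference `x` of the two candidates, `A x` is the difference of two residuals, both
  -- orthogonal to `x`; so `⟨x, A x⟩ = 0`.
  have hp := hpd _ (mem_krylov.2 ⟨_, hdeg, rfl⟩) hne
  have h1 := horth _ hdeg
  have h2 := h.orth _ hdeg
  rw [← polyVec_cgPoly_r, cgPoly_r_eq] at h2
  rw [real_inner_comm, ← polyVec_X_mul] at hp
  have : X * ((cgPoly A b n).v - q) = (1 - X * q) - (1 - X * (cgPoly A b n).v) := by ring
  rw [this, map_sub, inner_sub_left, h1, h2] at hp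
  simp at hp

/-- For `l ≤ k`, `rₖ₊₁` is orthogonal to `u_l`, so `⟨uₖ₊₁, u_l⟩ = βₖ ⟨uₖ, u_l⟩` with `βₖ ≥ 0`. -/
theorem inner_direction_nonneg (hA : A.IsSymmetric) (hg : GradeGE A b n)
    (hpd : ∀ x ∈ krylov A b n, x ≠ 0 → 0 < inner ℝ x (A x)) {k l : ℕ} (hlk : l ≤ k) (hk : k ≤ n) :
    0 ≤ inner ℝ (cgState A b k).u (cgState A b l).u := by
  induction k, hlk using Nat.le_induction with
  | base => exact real_inner_self_nonneg
  | succ k hlk ih =>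
    have h1 : inner ℝ (cgState A b (k + 1)).r (cgState A b l).u = 0 := by
      rw [← polyVec_cgPoly_u]
      refine (cgInvariant hA hg hpd hk).orth _ ?_
      rw [(cgInvariant hA hg hpd (by omega : l ≤ n)).degree_u]
      exact_mod_cast Nat.lt_succ_of_le hlk
    rw [cgState_u_succ, inner_add_left, inner_smul_left, h1, zero_add]
    exact mul_nonneg (cgBeta_nonneg A b k) (ih (by omega))

theorem inner_direction_iterate_nonneg (hA : A.IsSymmetric) (hg : GradeGE A b n)
    (hpd : ∀ x ∈ krylov A b n, x ≠ 0 → 0 < inner ℝ x (A x)) {k l : ℕ} (hlk : l ≤ k) (hk : k ≤ n) :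
    0 ≤ inner ℝ (cgState A b k).u (cgState A b l).v := by
  induction l with
  | zero => simp [cgState]
  | succ l ih =>
    rw [cgState_v_succ, inner_add_right, inner_smul_right]
    exact add_nonneg (ih (by omega)) (mul_nonneg (cgAlpha_pos hA hg hpd (by omega)).le
      (inner_direction_nonneg hA hg hpd (by omega) hk))

/-- Iterates are positive combinations of directions, so `vₖ - v_l` and `v_l` have nonnegative inner
product; expand the square of their sum. -/
theorem norm_iterate_sub_le (hA : A.IsSymmetric) (hg : GradeGE A b n)
    (hpd : ∀ x ∈ krylov A b n, x ≠ 0 → 0 < inner ℝ x (A x)) {k l : ℕ} (hlk : l ≤ k) (hk : k ≤ n) :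
    ‖(cgState A b k).v - (cgState A b l).v‖ ≤ ‖(cgState A b k).v‖ := by
  have h : 0 ≤ inner ℝ ((cgState A b k).v - (cgState A b l).v) (cgState A b l).v := by
    induction k, hlk using Nat.le_induction with
    | base => simp
    | succ k hlk ih =>
      rw [cgState_v_succ, add_sub_right_comm, inner_add_left, inner_smul_left]
      exact add_nonneg (ih (by omega)) (mul_nonneg (cgAlpha_pos hA hg hpd (by omega)).le
        (inner_direction_iterate_nonneg hA hg hpd hlk (by omega)))
  have h2 := norm_add_sq_real ((cgState A b k).v - (cgState A b l).v) (cgState A b l).v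
  rw [sub_add_cancel] at h2
  refine le_of_sq_le_sq ?_ (norm_nonneg _)
  nlinarith [sq_nonneg ‖(cgState A b l).v‖]

end Orthogonality

/-! ### Roots of orthogonal polynomials and definiteness on the Krylov space. -/

section Roots

variable {E : Type*} [NormedAddCommGroup E] [InnerProductSpace ℝ E]
variable {A : E →ₗ[ℝ] E} {b : E} {n : ℕ}

theorem GradeGE.mono (hg : GradeGE A b n) {k : ℕ} (hk : k ≤ n) : GradeGE A b k :=
  fun p hp => hg p (hp.trans_le (by exact_mod_cast hk))

/-- A polynomial of degree `n` that is orthogonal to all polynomials of lower degree has no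
root below a lower bound of the operator. -/
theorem le_of_eval_eq_zero (hg : GradeGE A b n) {l : ℝ}
    (hl : ∀ x : E, l * ‖x‖ ^ 2 ≤ inner ℝ (A x) x) {p : ℝ[X]} (hp : p.degree = n)
    (horth : ∀ q : ℝ[X], q.degree < n → inner ℝ (polyVec A b p) (polyVec A b q) = 0)
    {θ : ℝ} (hθ : p.eval θ = 0) : l ≤ θ := by
  have hp0 : p ≠ 0 := fun h => by simp [h] at hp
  obtain ⟨g, rfl⟩ := dvd_iff_isRoot.2 hθ
  have hg0 : g ≠ 0 := right_ne_zero_of_mul hp0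
  have hdeg : g.degree < n := by
    rw [← hp, degree_mul, degree_X_sub_C, degree_eq_natDegree hg0]
    exact_mod_cast (by omega : g.natDegree < 1 + g.natDegree)
  have hv : polyVec A b g ≠ 0 := fun h => hg0 (hg g hdeg h)
  -- With `p = (X - θ) g`, testing against `g` shows that `θ` is the Rayleigh quotient of `g(A) b`.
  have h := horth g hdeg
  rw [sub_mul, map_sub, polyVec_X_mul, polyVec_C_mul, inner_sub_left, inner_smul_left,
    real_inner_self_eq_norm_sq] at h
  have h1 := hl (polyVec A b g)
  have h2 : 0 < ‖polyVec A b g‖ ^ 2 := by positivity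
  simp only [conj_trivial] at h
  by_contra! hlt
  nlinarith

/-- A nonreal root `a + i c` gives `p = ((X - a)² + c²) g`. Testing against `g` yields `‖(A - a)
g(A) b‖² + c² ‖g(A) b‖² = 0`, which is impossible. -/
theorem splits_of_orthogonal (hA : A.IsSymmetric) (hg : GradeGE A b n) {p : ℝ[X]}
    (hp : p.degree = n)
    (horth : ∀ q : ℝ[X], q.degree < n → inner ℝ (polyVec A b p) (polyVec A b q) = 0) :
    p.Splits := by
  have hp0 : p ≠ 0 := fun h => by simp [h] at hp
  refine Splits.of_splits_map (algebraMap ℝ ℂ) (IsAlgClosed.splits _) fun z hz => ?_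
  have hz0 : aeval z p = 0 := by
    rw [mem_roots (Polynomial.map_ne_zero hp0), IsRoot.def, eval_map_algebraMap] at hz
    exact hz
  by_cases him : z.im = 0
  · exact ⟨z.re, Complex.ext (by simp) (by simp [him])⟩
  exfalso
  obtain ⟨g, hpg⟩ := p.quadratic_dvd_of_aeval_eq_zero_im_ne_zero hz0 him
  have hg0 : g ≠ 0 := by rintro rfl; simp at hpg; exact hp0 hpg
  have hquad : X ^ 2 - C (2 * z.re) * X + C (‖z‖ ^ 2)
      = (X - C z.re) * (X - C z.re) + C (z.im ^ 2) := by
    rw [Complex.sq_norm, Complex.normSq_apply]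
    simp only [map_mul, map_add, map_pow, map_ofNat]
    ring
  have hqdeg : (X ^ 2 - C (2 * z.re) * X + C (‖z‖ ^ 2) : ℝ[X]).degree = 2 := by
    compute_degree!
  have hdeg : g.degree < n := by
    rw [← hp, hpg, degree_mul, hqdeg, degree_eq_natDegree hg0]
    exact_mod_cast (by omega : g.natDegree < 2 + g.natDegree)
  have hv : polyVec A b g ≠ 0 := fun h => hg0 (hg g hdeg h)
  have h := horth g hdeg
  set a := z.re
  have hsplit : p = (X * ((X - C a) * g) - C a * ((X - C a) * g)) + C (z.im ^ 2) * g := by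
    rw [hpg, hquad]; ring
  have hlin : polyVec A b ((X - C a) * g) = A (polyVec A b g) - a • polyVec A b g := by
    rw [sub_mul, map_sub, polyVec_X_mul, polyVec_C_mul]
  rw [hsplit, map_add, map_sub, polyVec_X_mul, polyVec_C_mul, polyVec_C_mul, inner_add_left,
    inner_sub_left, hA, inner_smul_left, inner_smul_left, real_inner_self_eq_norm_sq] at h
  simp only [conj_trivial] at h
  rw [← inner_smul_right, ← inner_sub_right, ← hlin, real_inner_self_eq_norm_sq] at h
  have : 0 < ‖polyVec A b g‖ ^ 2 := by positivity
  have : 0 < z.im ^ 2 := by positivity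
  nlinarith [sq_nonneg ‖polyVec A b ((X - C a) * g)‖]

theorem eval_pos_of_no_root {p : ℝ[X]} {l : ℝ} (hl : 0 < l) (h0 : p.eval 0 = 1)
    (hroot : ∀ θ, p.eval θ = 0 → l ≤ θ) {x : ℝ} (hx : x < l) : 0 < p.eval x := by
  by_contra! hneg
  have hmem : (0 : ℝ) ∈ Set.uIcc (p.eval x) (p.eval 0) :=
    Set.mem_uIcc.2 (Or.inl ⟨hneg, by rw [h0]; exact zero_le_one⟩)
  obtain ⟨θ, hθ, h⟩ := intermediate_value_uIcc (p.continuous.continuousOn (s := Set.uIcc x 0)) hmem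
  have := hroot θ h
  rcases Set.mem_uIcc.1 hθ with h | h <;> linarith [h.1, h.2]

/-- If the orthogonal polynomial of degree `n` has no root in `(-∞, 0]`, then the operator is
positive definite on the Krylov space. -/
theorem inner_pos_of_no_root [FiniteDimensional ℝ E] (hA : A.IsSymmetric) (hg : GradeGE A b n)
    {p : ℝ[X]} (hp : p.degree = n)
    (horth : ∀ q : ℝ[X], q.degree < n → inner ℝ (polyVec A b p) (polyVec A b q) = 0)
    (hroot : ∀ θ ≤ 0, p.eval θ ≠ 0) :
    ∀ x ∈ krylov A b n, x ≠ 0 → 0 < inner ℝ x (A x) := by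
  set K := krylov A b n
  -- The compression of `A` to the Krylov space is symmetric, and its eigenvalues will be shown to
  -- be roots of `p`.
  set T : K →ₗ[ℝ] K := K.orthogonalProjectionOnto.toLinearMap ∘ₗ A ∘ₗ K.subtype
  have hTi : ∀ x y : K, inner ℝ (T x) y = inner ℝ (A x) (y : E) := fun x y =>
    Submodule.inner_orthogonalProjectionOnto_eq_of_mem_right y (A x)
  have hT : T.IsSymmetric := fun x y => by
    rw [hTi, hA, real_inner_comm, ← hTi, real_inner_comm]
  have hpos : ∀ i, 0 < hT.eigenvalues rfl i := by
    intro i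
    set θ := hT.eigenvalues rfl i
    by_contra! hθ
    obtain ⟨x, hx⟩ := (hT.hasEigenvalue_eigenvalues rfl i).exists_hasEigenvector
    have hx0 : (x : E) ≠ 0 := by simpa using hx.2
    have hxT : T x = θ • x := hx.apply_eq_smul
    obtain ⟨f, hf, hfx⟩ := mem_krylov.1 x.2
    have hf0 : f ≠ 0 := by rintro rfl; exact hx0 (by rw [← hfx, map_zero])
    -- If `f(A) b` is an eigenvector for `θ`, then `(X - θ) f` is orthogonal to degree `< n` and has
    -- degree at most `n`. It is thus a multiple of `p`; as `p(θ) ≠ 0`, the factor is `0`.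
    have horth' : ∀ q : ℝ[X], q.degree < n →
        inner ℝ (polyVec A b ((X - C θ) * f)) (polyVec A b q) = 0 := by
      intro q hq
      have := hTi x ⟨_, mem_krylov.2 ⟨q, hq, rfl⟩⟩
      rw [hxT] at this
      rw [sub_mul, map_sub, polyVec_X_mul, polyVec_C_mul, inner_sub_left, hfx, ← this]
      simp [Submodule.coe_inner]
    have hdeg : ((X - C θ) * f).degree < ((n + 1 : ℕ) : WithBot ℕ) := by
      rw [degree_mul, degree_X_sub_C, ← degree_X (R := ℝ), ← degree_mul]
      exact degree_X_mul_lt hf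
    obtain ⟨c, e, he, hce⟩ := exists_eq_C_mul_add hp hdeg
    have he0 : e = 0 := by
      refine hg e he ?_
      rw [← inner_self_eq_zero (𝕜 := ℝ)]
      have h1 := horth' e he
      have h2 := horth e he
      rw [hce, map_add, inner_add_left, polyVec_C_mul, inner_smul_left, h2] at h1
      simpa using h1
    rw [he0, add_zero] at hce
    have hev := congrArg (eval θ) hce
    rw [eval_mul, eval_mul, eval_sub, eval_X, eval_C, eval_C, sub_self, zero_mul] at hev
    have hc : c = 0 := (mul_eq_zero.1 hev.symm).resolve_right (hroot θ hθ)
    rw [hc, C_0, zero_mul] at hce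
    exact mul_ne_zero (X_sub_C_ne_zero θ) hf0 hce
  intro x hx hx0
  set y : K := ⟨x, hx⟩
  set e := hT.eigenvectorBasis rfl
  have hsum : inner ℝ x (A x) = ∑ i, hT.eigenvalues rfl i * inner ℝ (e i) y ^ 2 := by
    rw [real_inner_comm, ← hTi y y, real_inner_comm, ← e.sum_inner_mul_inner]
    refine Finset.sum_congr rfl fun i _ => ?_
    rw [← hT, hT.apply_eigenvectorBasis, real_inner_comm]
    simp only [inner_smul_left, RCLike.ofReal_real_eq_id, id, conj_trivial]
    ring
  rw [hsum]
  have hy : y ≠ 0 := fun h => hx0 (congrArg Subtype.val h)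
  obtain ⟨i, hi⟩ : ∃ i, inner ℝ (e i) y ≠ 0 := by
    by_contra! h
    exact hy (InnerProductSpace.ext_inner_left_basis e.toBasis fun i => by simpa using h i)
  exact Finset.sum_pos' (fun j _ => mul_nonneg (hpos j).le (sq_nonneg _))
    ⟨i, Finset.mem_univ _, mul_pos (hpos i) (by positivity)⟩

end Roots

/-! ### Product bounds for polynomials with real roots. -/

section Bounds

theorem multiset_prod_le_pow (s : Multiset ℝ) (f : ℝ → ℝ) {c : ℝ}
    (h : ∀ θ ∈ s, 0 ≤ f θ ∧ f θ ≤ c) : (s.map f).prod ≤ c ^ s.card := by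
  -- Nonnegativity is carried along because the induction multiplies inequalities.
  have : 0 ≤ (s.map f).prod ∧ (s.map f).prod ≤ c ^ s.card := by
    induction s using Multiset.induction_on with
    | empty => simp
    | cons a s ih =>
      obtain ⟨h1, h2⟩ := ih fun θ hθ => h θ (Multiset.mem_cons_of_mem hθ)
      obtain ⟨h3, h4⟩ := h a (Multiset.mem_cons_self a s)
      rw [Multiset.map_cons, Multiset.prod_cons, Multiset.card_cons, pow_succ']
      exact ⟨mul_nonneg h3 h1, mul_le_mul h4 h2 h1 (h3.trans h4)⟩
  exact this.2

theorem pow_le_multiset_prod (s : Multiset ℝ) (f : ℝ → ℝ) {c : ℝ} (hc : 0 ≤ c)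
    (h : ∀ θ ∈ s, c ≤ f θ) : c ^ s.card ≤ (s.map f).prod := by
  induction s using Multiset.induction_on with
  | empty => simp
  | cons a s ih =>
    have h1 := ih fun θ hθ => h θ (Multiset.mem_cons_of_mem hθ)
    have h2 := h a (Multiset.mem_cons_self a s)
    rw [Multiset.map_cons, Multiset.prod_cons, Multiset.card_cons, pow_succ']
    exact mul_le_mul h2 h1 (pow_nonneg hc _) (hc.trans h2)

theorem eval_eq_prod_one_sub_div {p : ℝ[X]} (hs : p.Splits) (h0 : p.eval 0 = 1) (x : ℝ) :
    p.eval x = (p.roots.map fun θ => 1 - x / θ).prod := by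
  have hne : ∀ θ ∈ p.roots, θ ≠ 0 := by
    rintro θ hθ rfl
    have := isRoot_of_mem_roots hθ
    rw [IsRoot.def, h0] at this
    exact one_ne_zero this
  have h1 := hs.eval_eq_prod_roots x
  have h2 := hs.eval_eq_prod_roots 0
  have h3 : (p.roots.map fun θ => x - θ).prod
      = (p.roots.map fun θ => 0 - θ).prod * (p.roots.map fun θ => 1 - x / θ).prod := by
    rw [← Multiset.prod_map_mul]
    refine congrArg _ (Multiset.map_congr rfl fun θ hθ => ?_)
    have := hne θ hθ
    field_simp
    ring
  rw [h1, h3, ← mul_assoc, ← h2, h0, one_mul]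

/-- Let `1 - X q` have degree `n` and only real roots, all of them at least `l > 0`. Then `q` is
bounded below `l` by the corresponding polynomial for `(1 - X / l) ^ n`. -/
theorem eval_le_tailBound {p q : ℝ[X]} {l : ℝ} {n : ℕ} (hl : 0 < l) (hp : p.natDegree = n)
    (hs : p.Splits) (hroot : ∀ θ, p.eval θ = 0 → l ≤ θ) (hpq : p = 1 - X * q)
    {x : ℝ} (hx : x < l) : q.eval x ≤ tailBound l x n := by
  have h0 : p.eval 0 = 1 := by simp [hpq]
  have hcard : p.roots.card = n := by rw [← hs.natDegree_eq_card_roots, hp]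
  have hr : ∀ θ ∈ p.roots, l ≤ θ := fun θ hθ => hroot θ (isRoot_of_mem_roots hθ)
  have hev := eval_eq_prod_one_sub_div hs h0 x
  have hpx : p.eval x = 1 - x * q.eval x := by simp [hpq]
  unfold tailBound
  split_ifs with hx0
  -- The logarithmic derivative of `p` at `0` gives `q(0) = ∑ 1/θ ≤ n/l`.
  · have h1 := hs.eval_derivative_div_eval_of_ne_zero (x := 0) (by rw [h0]; exact one_ne_zero)
    have h2 : p.derivative.eval 0 = - q.eval 0 := by simp [hpq]
    have h3 : (p.roots.map fun θ => 1 / θ).sum ≤ n * (1 / l) := by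
      have := Multiset.sum_le_card_nsmul (p.roots.map fun θ => 1 / θ) (1 / l) (by
        intro y hy
        obtain ⟨θ, hθ, rfl⟩ := Multiset.mem_map.1 hy
        exact one_div_le_one_div_of_le hl (hr θ hθ))
      simpa [hcard] using this
    have h4 : (p.roots.map fun θ => 1 / (0 - θ)).sum = - (p.roots.map fun θ => 1 / θ).sum := by
      rw [← Multiset.sum_map_neg]
      refine congrArg _ (Multiset.map_congr rfl fun θ _ => ?_)
      rw [zero_sub, div_neg]
    rw [h2, h0, h4] at h1
    rw [hx0, div_eq_mul_one_div]
    linarith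
  -- The comparison of `1 - x/θ` with `1 - x/l` reverses with the sign of `x`, and so does division
  -- by `x` in `q(x) = (1 - p(x))/x`; the bound on `q` is the same in both cases.
  · rcases lt_or_gt_of_ne hx0 with hneg | hpos
    · have h1 : p.eval x ≤ (1 - x / l) ^ n := by
        rw [hev, ← hcard]
        refine multiset_prod_le_pow _ _ fun θ hθ => ?_
        have hθ' := hr θ hθ
        have hθ0 : 0 < θ := hl.trans_le hθ'
        have h2 : x / l ≤ x / θ := by
          rw [div_le_div_iff₀ hl hθ0]; nlinarith
        have h3 : x / θ ≤ 0 := div_nonpos_of_nonpos_of_nonneg hneg.le hθ0.le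
        constructor <;> linarith
      refine le_trans ?_ (neg_le_abs _)
      rw [← div_neg, le_div_iff₀ (by linarith)]
      linarith
    · have h1 : (1 - x / l) ^ n ≤ p.eval x := by
        rw [hev, ← hcard]
        refine pow_le_multiset_prod _ _ ?_ fun θ hθ => ?_
        · have := (div_lt_one hl).2 hx
          linarith
        · have := div_le_div_of_nonneg_left hpos.le hl (hr θ hθ)
          linarith
      refine le_trans ?_ (neg_le_abs _)
      rw [← neg_div, le_div_iff₀ hpos]
      linarith

end Bounds

/-! ### CG for a positive definite operator: values below the spectrum and the kernel. -/

section Coercive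

variable {E : Type*} [NormedAddCommGroup E] [InnerProductSpace ℝ E]
variable {A : E →ₗ[ℝ] E} {b : E} {n : ℕ} {l : ℝ}

theorem inner_pos_of_coercive (hl0 : 0 < l) (hl : ∀ x : E, l * ‖x‖ ^ 2 ≤ inner ℝ (A x) x) :
    ∀ x ∈ krylov A b n, x ≠ 0 → 0 < inner ℝ x (A x) := by
  intro x _ hx
  rw [real_inner_comm]
  exact lt_of_lt_of_le (by positivity) (hl x)

theorem polyVec_cgPoly_r_orth (hA : A.IsSymmetric) (hg : GradeGE A b n) (hl0 : 0 < l)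
    (hl : ∀ x : E, l * ‖x‖ ^ 2 ≤ inner ℝ (A x) x) {k : ℕ} (hk : k ≤ n) {q : ℝ[X]}
    (hq : q.degree < k) : inner ℝ (polyVec A b (cgPoly A b k).r) (polyVec A b q) = 0 := by
  rw [polyVec_cgPoly_r]
  exact (cgInvariant hA hg (inner_pos_of_coercive hl0 hl) hk).orth q hq

theorem cgPoly_r_root_ge (hA : A.IsSymmetric) (hg : GradeGE A b n) (hl0 : 0 < l)
    (hl : ∀ x : E, l * ‖x‖ ^ 2 ≤ inner ℝ (A x) x) {k : ℕ} (hk : k ≤ n) (θ : ℝ)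
    (hθ : (cgPoly A b k).r.eval θ = 0) : l ≤ θ :=
  le_of_eval_eq_zero (hg.mono hk) hl
    (cgInvariant hA hg (inner_pos_of_coercive hl0 hl) hk).degree_r
    (fun _ hq => polyVec_cgPoly_r_orth hA hg hl0 hl hk hq) hθ

theorem cgPoly_r_eval_pos (hA : A.IsSymmetric) (hg : GradeGE A b n) (hl0 : 0 < l)
    (hl : ∀ x : E, l * ‖x‖ ^ 2 ≤ inner ℝ (A x) x) {k : ℕ} (hk : k ≤ n) {x : ℝ} (hx : x < l) :
    0 < (cgPoly A b k).r.eval x :=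
  eval_pos_of_no_root hl0 (cgPoly_r_eval_zero A b k) (cgPoly_r_root_ge hA hg hl0 hl hk) hx

theorem cgPoly_u_eval_nonneg (hA : A.IsSymmetric) (hg : GradeGE A b n) (hl0 : 0 < l)
    (hl : ∀ x : E, l * ‖x‖ ^ 2 ≤ inner ℝ (A x) x) {k : ℕ} (hk : k ≤ n) {x : ℝ} (hx : x < l) :
    0 ≤ (cgPoly A b k).u.eval x := by
  induction k with
  | zero => simp [cgPoly]
  | succ k ih =>
    rw [cgPoly_u_succ, eval_add, eval_mul, eval_C]
    exact add_nonneg (cgPoly_r_eval_pos hA hg hl0 hl hk hx).le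
      (mul_nonneg (cgBeta_nonneg A b k) (ih (by omega)))

/-- Each increment `αₖ uₖ(x)` is nonnegative, since `uₖ` is a nonnegative combination of residual
polynomials, all positive below `l`. -/
theorem cgPoly_v_eval_mono (hA : A.IsSymmetric) (hg : GradeGE A b n) (hl0 : 0 < l)
    (hl : ∀ x : E, l * ‖x‖ ^ 2 ≤ inner ℝ (A x) x) {j k : ℕ} (hjk : j ≤ k) (hk : k ≤ n) {x : ℝ}
    (hx : x < l) : (cgPoly A b j).v.eval x ≤ (cgPoly A b k).v.eval x := by
  induction k, hjk using Nat.le_induction with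
  | base => exact le_rfl
  | succ k hjk ih =>
    refine (ih (by omega)).trans ?_
    rw [cgPoly_v_succ, eval_add, eval_mul, eval_C]
    exact le_add_of_nonneg_right
      (mul_nonneg (cgAlpha_pos hA hg (inner_pos_of_coercive hl0 hl) hk).le
        (cgPoly_u_eval_nonneg hA hg hl0 hl (by omega) hx))

theorem cgPoly_v_eval_nonneg (hA : A.IsSymmetric) (hg : GradeGE A b n) (hl0 : 0 < l)
    (hl : ∀ x : E, l * ‖x‖ ^ 2 ≤ inner ℝ (A x) x) {k : ℕ} (hk : k ≤ n) {x : ℝ}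
    (hx : x < l) : 0 ≤ (cgPoly A b k).v.eval x := by
  simpa [cgPoly] using cgPoly_v_eval_mono hA hg hl0 hl (Nat.zero_le k) hk hx

theorem cgPoly_r_eval_mono (hA : A.IsSymmetric) (hg : GradeGE A b n) (hl0 : 0 < l)
    (hl : ∀ x : E, l * ‖x‖ ^ 2 ≤ inner ℝ (A x) x) {j k : ℕ} (hjk : j ≤ k) (hk : k ≤ n) {x : ℝ}
    (hx : x ≤ 0) : (cgPoly A b j).r.eval x ≤ (cgPoly A b k).r.eval x := by
  have := cgPoly_v_eval_mono hA hg hl0 hl hjk hk (hx.trans_lt hl0)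
  simp only [cgPoly_r_eq, eval_sub, eval_one, eval_mul, eval_X]
  nlinarith

theorem cgPoly_v_eval_le_tailBound (hA : A.IsSymmetric) (hg : GradeGE A b n) (hl0 : 0 < l)
    (hl : ∀ x : E, l * ‖x‖ ^ 2 ≤ inner ℝ (A x) x) {x : ℝ} (hx : x < l) :
    (cgPoly A b n).v.eval x ≤ tailBound l x n := by
  have h := (cgInvariant hA hg (inner_pos_of_coercive hl0 hl) le_rfl).degree_r
  exact eval_le_tailBound hl0 (natDegree_eq_of_degree_eq_some h)
    (splits_of_orthogonal hA hg h fun _ hq => polyVec_cgPoly_r_orth hA hg hl0 hl le_rfl hq)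
    (cgPoly_r_root_ge hA hg hl0 hl le_rfl) (cgPoly_r_eq A b n) hx

/-- The reproducing kernel at `x` of the polynomials of degree less than `n`, for the inner
product `⟨p(A) b, q(A) b⟩`. -/
def cgKernel (A : E →ₗ[ℝ] E) (b : E) (x : ℝ) (n : ℕ) : ℝ[X] :=
  ∑ k ∈ Finset.range n, C ((cgPoly A b k).r.eval x / ‖(cgState A b k).r‖ ^ 2) * (cgPoly A b k).r

theorem degree_cgKernel_lt (hA : A.IsSymmetric) (hg : GradeGE A b n) (hl0 : 0 < l)
    (hl : ∀ x : E, l * ‖x‖ ^ 2 ≤ inner ℝ (A x) x) (x : ℝ) {k : ℕ} (hk : k ≤ n) :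
    (cgKernel A b x k).degree < k := by
  rw [← mem_degreeLT]
  refine Submodule.sum_mem _ fun i hi => ?_
  rw [← smul_eq_C_mul]
  refine Submodule.smul_mem _ _ (mem_degreeLT.2 ?_)
  rw [Finset.mem_range] at hi
  rw [(cgInvariant hA hg (inner_pos_of_coercive hl0 hl) (by omega)).degree_r]
  exact_mod_cast hi

/-- The residual polynomials form an orthogonal basis; each step of the induction adds one basis
element to both the kernel and the test polynomial. -/
theorem inner_cgKernel (hA : A.IsSymmetric) (hg : GradeGE A b n) (hl0 : 0 < l)
    (hl : ∀ x : E, l * ‖x‖ ^ 2 ≤ inner ℝ (A x) x) (x : ℝ) {k : ℕ} (hk : k ≤ n) {q : ℝ[X]}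
    (hq : q.degree < k) :
    inner ℝ (polyVec A b (cgKernel A b x k)) (polyVec A b q) = q.eval x := by
  induction k generalizing q with
  | zero =>
    have : q = 0 := by simpa using hq
    simp [this]
  | succ k ih =>
    have hinv := cgInvariant hA hg (inner_pos_of_coercive hl0 hl) (by omega : k ≤ n)
    obtain ⟨c, q', hq', rfl⟩ := exists_eq_C_mul_add hinv.degree_r hq
    have h1 := ih (by omega) hq'
    have h2 : inner ℝ (polyVec A b (cgKernel A b x k)) (cgState A b k).r = 0 := by
      rw [real_inner_comm]
      exact hinv.orth _ (degree_cgKernel_lt hA hg hl0 hl x (by omega))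
    have h3 := hinv.orth _ hq'
    have h4 : ‖(cgState A b k).r‖ ≠ 0 := norm_ne_zero_iff.2 (hinv.r_ne_zero hg hk)
    have hsucc : cgKernel A b x (k + 1) = cgKernel A b x k +
        C ((cgPoly A b k).r.eval x / ‖(cgState A b k).r‖ ^ 2) * (cgPoly A b k).r :=
      Finset.sum_range_succ _ _
    simp only [hsucc, map_add, polyVec_C_mul, polyVec_cgPoly_r, inner_add_left, inner_add_right,
      inner_smul_left, inner_smul_right, h1, h2, h3, real_inner_self_eq_norm_sq, conj_trivial,
      eval_add, eval_mul, eval_C]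
    field_simp
    ring

theorem cgKernel_eval_pos (hA : A.IsSymmetric) (hg : GradeGE A b n) (hl0 : 0 < l)
    (hl : ∀ x : E, l * ‖x‖ ^ 2 ≤ inner ℝ (A x) x) (hn : 1 ≤ n) {x y : ℝ} (hx : x < l)
    (hy : y < l) : 0 < (cgKernel A b x n).eval y := by
  rw [cgKernel, eval_finsetSum]
  refine Finset.sum_pos (fun k hk => ?_) ⟨0, Finset.mem_range.2 hn⟩
  rw [Finset.mem_range] at hk
  have h1 := cgPoly_r_eval_pos hA hg hl0 hl hk.le hx
  have h2 := cgPoly_r_eval_pos hA hg hl0 hl hk.le hy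
  have h3 := (cgInvariant hA hg (inner_pos_of_coercive hl0 hl) hk.le).r_ne_zero hg hk
  rw [eval_mul, eval_C]
  positivity

theorem norm_polyVec_cgKernel_sq (hA : A.IsSymmetric) (hg : GradeGE A b n) (hl0 : 0 < l)
    (hl : ∀ x : E, l * ‖x‖ ^ 2 ≤ inner ℝ (A x) x) (x : ℝ) :
    ‖polyVec A b (cgKernel A b x n)‖ ^ 2 = (cgKernel A b x n).eval x := by
  rw [← real_inner_self_eq_norm_sq]
  exact inner_cgKernel hA hg hl0 hl x le_rfl (degree_cgKernel_lt hA hg hl0 hl x le_rfl)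

/-- The weights which express the normalized kernel polynomial through the residual
polynomials of the conjugate gradient method. -/
def cgWeight (A : E →ₗ[ℝ] E) (b : E) (x : ℝ) (n k : ℕ) : ℝ :=
  (cgPoly A b k).r.eval x / ‖(cgState A b k).r‖ ^ 2 / (cgKernel A b x n).eval 0

theorem cgWeight_nonneg (hA : A.IsSymmetric) (hg : GradeGE A b n) (hl0 : 0 < l)
    (hl : ∀ x : E, l * ‖x‖ ^ 2 ≤ inner ℝ (A x) x) (hn : 1 ≤ n) {x : ℝ} (hx : x < l) {k : ℕ}
    (hk : k ≤ n) : 0 ≤ cgWeight A b x n k := by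
  have h1 := cgPoly_r_eval_pos hA hg hl0 hl hk hx
  have h2 := cgKernel_eval_pos hA hg hl0 hl hn hx hl0
  unfold cgWeight
  positivity

/-- As `rₖ(0) = 1`, the value of the kernel at `0` is the sum of its coefficients. With
nonnegativity this makes the weights convex. -/
theorem sum_cgWeight (hA : A.IsSymmetric) (hg : GradeGE A b n) (hl0 : 0 < l)
    (hl : ∀ x : E, l * ‖x‖ ^ 2 ≤ inner ℝ (A x) x) (hn : 1 ≤ n) {x : ℝ} (hx : x < l) :
    ∑ k ∈ Finset.range n, cgWeight A b x n k = 1 := by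
  have h := cgKernel_eval_pos hA hg hl0 hl hn hx hl0
  unfold cgWeight
  rw [← Finset.sum_div, div_eq_one_iff_eq h.ne']
  simp [cgKernel, eval_finsetSum, cgPoly_r_eval_zero]

/-- The polynomial `h` for which `1 - X h` is the kernel polynomial, normalized at `0`. -/
def cgKernelIterate (A : E →ₗ[ℝ] E) (b : E) (x : ℝ) (n : ℕ) : ℝ[X] :=
  ∑ k ∈ Finset.range n, C (cgWeight A b x n k) * (cgPoly A b k).v

theorem normalized_cgKernel_eq_sum (x : ℝ) :
    C ((cgKernel A b x n).eval 0)⁻¹ * cgKernel A b x n =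
      ∑ k ∈ Finset.range n, C (cgWeight A b x n k) * (cgPoly A b k).r := by
  conv_lhs => rw [cgKernel.eq_def A b x n, Finset.mul_sum]
  rw [← cgKernel.eq_def]
  refine Finset.sum_congr rfl fun k _ => ?_
  rw [← mul_assoc, ← C_mul, cgWeight, div_eq_inv_mul _ (eval _ _)]

theorem normalized_cgKernel_eq (hA : A.IsSymmetric) (hg : GradeGE A b n) (hl0 : 0 < l)
    (hl : ∀ x : E, l * ‖x‖ ^ 2 ≤ inner ℝ (A x) x) (hn : 1 ≤ n) {x : ℝ} (hx : x < l) :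
    C ((cgKernel A b x n).eval 0)⁻¹ * cgKernel A b x n = 1 - X * cgKernelIterate A b x n := by
  rw [normalized_cgKernel_eq_sum, cgKernelIterate, Finset.mul_sum, ← C_1,
    ← sum_cgWeight hA hg hl0 hl hn hx, map_sum, ← Finset.sum_sub_distrib]
  refine Finset.sum_congr rfl fun k _ => ?_
  rw [cgPoly_r_eq]
  ring

theorem degree_cgKernelIterate_lt (hA : A.IsSymmetric) (hg : GradeGE A b n) (hl0 : 0 < l)
    (hl : ∀ x : E, l * ‖x‖ ^ 2 ≤ inner ℝ (A x) x) (x : ℝ) :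
    (cgKernelIterate A b x n).degree < n := by
  rw [← mem_degreeLT]
  refine Submodule.sum_mem _ fun k hk => ?_
  rw [← smul_eq_C_mul]
  refine Submodule.smul_mem _ _ (mem_degreeLT.2 ?_)
  rw [Finset.mem_range] at hk
  exact (cgInvariant hA hg (inner_pos_of_coercive hl0 hl) hk.le).degree_v.trans
    (by exact_mod_cast hk)

theorem sub_cgKernelIterate_eq (hA : A.IsSymmetric) (hg : GradeGE A b n) (hl0 : 0 < l)
    (hl : ∀ x : E, l * ‖x‖ ^ 2 ≤ inner ℝ (A x) x) (hn : 1 ≤ n) {x : ℝ} (hx : x < l) :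
    (cgPoly A b n).v - cgKernelIterate A b x n =
      ∑ k ∈ Finset.range n, C (cgWeight A b x n k) * ((cgPoly A b n).v - (cgPoly A b k).v) := by
  simp only [mul_sub, Finset.sum_sub_distrib, ← Finset.sum_mul, ← map_sum,
    sum_cgWeight hA hg hl0 hl hn hx, C_1, one_mul, cgKernelIterate]

theorem norm_sub_cgKernelIterate_le (hA : A.IsSymmetric) (hg : GradeGE A b n) (hl0 : 0 < l)
    (hl : ∀ x : E, l * ‖x‖ ^ 2 ≤ inner ℝ (A x) x) (hn : 1 ≤ n) {x : ℝ} (hx : x < l) :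
    ‖polyVec A b ((cgPoly A b n).v - cgKernelIterate A b x n)‖ ≤ ‖cgIterate A b n‖ := by
  rw [sub_cgKernelIterate_eq hA hg hl0 hl hn hx, map_sum]
  refine (norm_sum_le _ _).trans ?_
  rw [← one_mul ‖cgIterate A b n‖, ← sum_cgWeight hA hg hl0 hl hn hx, Finset.sum_mul]
  refine Finset.sum_le_sum fun k hk => ?_
  rw [Finset.mem_range] at hk
  have hw := cgWeight_nonneg hA hg hl0 hl hn hx hk.le
  rw [polyVec_C_mul, norm_smul, Real.norm_of_nonneg hw, map_sub, polyVec_cgPoly_v,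
    polyVec_cgPoly_v]
  exact mul_le_mul_of_nonneg_left
    (norm_iterate_sub_le hA hg (inner_pos_of_coercive hl0 hl) hk.le le_rfl) hw

theorem eval_sub_cgKernelIterate_mem_Icc (hA : A.IsSymmetric) (hg : GradeGE A b n) (hl0 : 0 < l)
    (hl : ∀ x : E, l * ‖x‖ ^ 2 ≤ inner ℝ (A x) x) (hn : 1 ≤ n) {x y : ℝ} (hx : x < l)
    (hy : y < l) :
    ((cgPoly A b n).v - cgKernelIterate A b x n).eval y ∈
      Set.Icc 0 ((cgPoly A b n).v.eval y) := by
  constructor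
  · rw [sub_cgKernelIterate_eq hA hg hl0 hl hn hx, eval_finsetSum]
    refine Finset.sum_nonneg fun k hk => ?_
    rw [Finset.mem_range] at hk
    rw [eval_mul, eval_C, eval_sub]
    exact mul_nonneg (cgWeight_nonneg hA hg hl0 hl hn hx hk.le)
      (sub_nonneg.2 (cgPoly_v_eval_mono hA hg hl0 hl hk.le le_rfl hy))
  · rw [eval_sub, sub_le_self_iff, cgKernelIterate, eval_finsetSum]
    refine Finset.sum_nonneg fun k hk => ?_
    rw [Finset.mem_range] at hk
    rw [eval_mul, eval_C]
    exact mul_nonneg (cgWeight_nonneg hA hg hl0 hl hn hx hk.le)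
      (cgPoly_v_eval_nonneg hA hg hl0 hl hk.le hy)

/-- A convex combination of the `rₖ(y)`, `k < n`, where `0 < rₖ(y) ≤ rₙ(y)` because `y ≤ 0`. -/
theorem abs_normalized_cgKernel_eval_le (hA : A.IsSymmetric) (hg : GradeGE A b n) (hl0 : 0 < l)
    (hl : ∀ x : E, l * ‖x‖ ^ 2 ≤ inner ℝ (A x) x) (hn : 1 ≤ n) {x y : ℝ} (hx : x < l)
    (hy : y ≤ 0) :
    |(C ((cgKernel A b x n).eval 0)⁻¹ * cgKernel A b x n).eval y| ≤ (cgPoly A b n).r.eval y := by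
  rw [normalized_cgKernel_eq_sum, eval_finsetSum]
  refine (Finset.abs_sum_le_sum_abs _ _).trans ?_
  rw [← one_mul ((cgPoly A b n).r.eval y), ← sum_cgWeight hA hg hl0 hl hn hx, Finset.sum_mul]
  refine Finset.sum_le_sum fun k hk => ?_
  rw [Finset.mem_range] at hk
  have hw := cgWeight_nonneg hA hg hl0 hl hn hx hk.le
  rw [eval_mul, eval_C, abs_mul, abs_of_nonneg hw,
    abs_of_pos (cgPoly_r_eval_pos hA hg hl0 hl hk.le (hy.trans_lt hl0))]
  exact mul_le_mul_of_nonneg_left (cgPoly_r_eval_mono hA hg hl0 hl hk.le le_rfl hy) hw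

/-- A polynomial which is orthogonal to its difference to `q` has a seminorm at most that of `q`,
with equality only for polynomials equal to it. -/
theorem eq_of_norm_polyVec_le (hg : GradeGE A b n) {p q : ℝ[X]} (hd : (q - p).degree < n)
    (horth : inner ℝ (polyVec A b p) (polyVec A b (q - p)) = 0) :
    ‖polyVec A b p‖ ^ 2 ≤ ‖polyVec A b q‖ ^ 2 ∧
      (‖polyVec A b q‖ ^ 2 ≤ ‖polyVec A b p‖ ^ 2 → q = p) := by
  have h := norm_add_sq_real (polyVec A b p) (polyVec A b (q - p))
  rw [horth, ← map_add, add_sub_cancel] at h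
  constructor
  · nlinarith [sq_nonneg ‖polyVec A b (q - p)‖]
  · intro h1
    have h2 : ‖polyVec A b (q - p)‖ ^ 2 = 0 := by
      nlinarith [sq_nonneg ‖polyVec A b (q - p)‖]
    rw [sq_eq_zero_iff, norm_eq_zero] at h2
    exact sub_eq_zero.1 (hg _ hd h2)

end Coercive

/-! ### The minimizing polynomials of a diagonal system in terms of CG. -/

section Diagonal

variable {N : ℕ} (lam b : Fin N → ℝ)

theorem diagOp_apply (x : EuclideanSpace ℝ (Fin N)) (i : Fin N) :
    diagOp lam x i = lam i * x i := by
  simp [diagOp, Matrix.toLpLin_apply, Matrix.mulVec_diagonal]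

theorem diagOp_isSymmetric : (diagOp lam).IsSymmetric := by
  intro x y
  simp only [PiLp.inner_apply, diagOp_apply]
  refine Finset.sum_congr rfl fun i _ => ?_
  simp
  ring

theorem le_inner_diagOp {lam : Fin N → ℝ} {l : ℝ} (h : ∀ i, l ≤ lam i)
    (x : EuclideanSpace ℝ (Fin N)) : l * ‖x‖ ^ 2 ≤ inner ℝ (diagOp lam x) x := by
  rw [EuclideanSpace.real_norm_sq_eq, PiLp.inner_apply, Finset.mul_sum]
  refine Finset.sum_le_sum fun i _ => ?_
  rw [diagOp_apply]
  simp only [RCLike.inner_apply, conj_trivial]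
  nlinarith [mul_le_mul_of_nonneg_right (h i) (sq_nonneg (x i))]

theorem polyVec_diagOp (p : ℝ[X]) (i : Fin N) :
    polyVec (diagOp lam) (WithLp.toLp 2 b) p i = p.eval (lam i) * b i := by
  induction p using Polynomial.induction_on' with
  | add p q hp hq => simp [map_add, hp, hq, add_mul]
  | monomial k a =>
    induction k with
    | zero => rw [monomial_zero_left, ← mul_one (C a), polyVec_C_mul]; simp
    | succ k ih =>
      have : (monomial (k + 1) a : ℝ[X]) = X * monomial k a := by rw [X_mul_monomial]
      rw [this, polyVec_X_mul, diagOp_apply, ih, eval_mul, eval_X, mul_assoc]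

theorem inner_polyVec_diagOp (p q : ℝ[X]) :
    inner ℝ (polyVec (diagOp lam) (WithLp.toLp 2 b) p)
      (polyVec (diagOp lam) (WithLp.toLp 2 b) q) =
      ∑ i, b i ^ 2 * (p.eval (lam i) * q.eval (lam i)) := by
  rw [PiLp.inner_apply]
  refine Finset.sum_congr rfl fun i _ => ?_
  rw [polyVec_diagOp, polyVec_diagOp]
  simp
  ring

theorem polyNormSq_eq (p : ℝ[X]) :
    polyNormSq lam b p = ‖polyVec (diagOp lam) (WithLp.toLp 2 b) p‖ ^ 2 := by
  rw [← real_inner_self_eq_norm_sq, inner_polyVec_diagOp, polyNormSq]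
  exact Finset.sum_congr rfl fun i _ => by ring

variable {lam b} {n : ℕ} {l : ℝ}

/-- Monic competitors differ by degree `< n`, so the monic multiple of `rₙ` is the unique minimizer;
scaling back to value `1` at `0` recovers `rₙ`. -/
theorem varsigma_eq (hg : GradeGE (diagOp lam) (WithLp.toLp 2 b) n) (hl0 : 0 < l)
    (hl : ∀ i, l ≤ lam i) :
    varsigma lam b n = (cgPoly (diagOp lam) (WithLp.toLp 2 b) n).r := by
  set A := diagOp lam
  set β : EuclideanSpace ℝ (Fin N) := WithLp.toLp 2 b
  have hA : A.IsSymmetric := diagOp_isSymmetric lam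
  have hc := le_inner_diagOp hl
  set ρ := (cgPoly A β n).r
  have hdeg : ρ.degree = n := (cgInvariant hA hg (inner_pos_of_coercive hl0 hc) le_rfl).degree_r
  have hlead : ρ.coeff n ≠ 0 := coeff_ne_zero_of_eq_degree hdeg
  set p := C (ρ.coeff n)⁻¹ * ρ
  have hp1 : p.coeff n = 1 := by simp [p, hlead]
  have hpd : p.natDegree ≤ n := by
    refine (natDegree_C_mul_le _ _).trans ?_
    rw [natDegree_eq_of_degree_eq_some hdeg]
  have hsub : ∀ q : ℝ[X], q.natDegree ≤ n → q.coeff n = 1 → (q - p).degree < n := by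
    intro q hq hq1
    rw [degree_lt_iff_coeff_zero]
    intro m hm
    rcases hm.eq_or_lt with h | h
    · rw [coeff_sub, ← h, hp1, hq1, sub_self]
    · rw [coeff_sub, coeff_eq_zero_of_natDegree_lt (hq.trans_lt h),
        coeff_eq_zero_of_natDegree_lt (hpd.trans_lt h), sub_self]
  have horth : ∀ q : ℝ[X], q.degree < n → inner ℝ (polyVec A β p) (polyVec A β q) = 0 := by
    intro q hq
    rw [polyVec_C_mul, inner_smul_left, polyVec_cgPoly_r_orth hA hg hl0 hc le_rfl hq, mul_zero]
  have hmin : IsLanczos lam b n p := by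
    refine ⟨hpd, hp1, fun q hq hq1 => ?_⟩
    rw [polyNormSq_eq, polyNormSq_eq]
    exact (eq_of_norm_polyVec_le hg (hsub q hq hq1) (horth _ (hsub q hq hq1))).1
  have hspec : IsLanczos lam b n (lanczos lam b n) := Classical.epsilon_spec ⟨p, hmin⟩
  have heq : lanczos lam b n = p := by
    have h := hspec.2.2 p hpd hp1
    rw [polyNormSq_eq, polyNormSq_eq] at h
    have hd := hsub _ hspec.1 hspec.2.1
    exact (eq_of_norm_polyVec_le hg hd (horth _ hd)).2 h
  have h0 : ρ.eval 0 = 1 := cgPoly_r_eval_zero A β n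
  rw [varsigma, heq, eval_mul, eval_C, h0, mul_one, inv_inv, ← mul_assoc, ← C_mul,
    mul_inv_cancel₀ hlead, C_1, one_mul]

/-- Two competitors differ by a polynomial vanishing at `x`, and the kernel at `x` is orthogonal to
those of degree `< n`. -/
theorem zeta_eq (hg : GradeGE (diagOp lam) (WithLp.toLp 2 b) n) (hl0 : 0 < l)
    (hl : ∀ i, l ≤ lam i) (hn : 1 ≤ n) {x : ℝ} (hx : x < l) :
    zeta lam b x (n - 1) =
      C ((cgKernel (diagOp lam) (WithLp.toLp 2 b) x n).eval x)⁻¹ *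
        cgKernel (diagOp lam) (WithLp.toLp 2 b) x n := by
  set A := diagOp lam
  set β : EuclideanSpace ℝ (Fin N) := WithLp.toLp 2 b
  have hA : A.IsSymmetric := diagOp_isSymmetric lam
  have hc := le_inner_diagOp hl
  set κ := cgKernel A β x n
  have hκx : 0 < κ.eval x := cgKernel_eval_pos hA hg hl0 hc hn hx hx
  have hnd : ∀ q : ℝ[X], q.natDegree ≤ n - 1 ↔ q.degree < n := by
    intro q
    rw [degree_lt_iff_coeff_zero, natDegree_le_iff_coeff_eq_zero]
    exact ⟨fun h k hk => h k (by omega), fun h k hk => h k (by omega)⟩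
  set p := C (κ.eval x)⁻¹ * κ
  have hp1 : p.eval x = 1 := by simp [p, hκx.ne']
  have hpd : p.degree < n := by
    rw [← mem_degreeLT]
    simp only [p, ← smul_eq_C_mul]
    exact Submodule.smul_mem _ _ (mem_degreeLT.2 (degree_cgKernel_lt hA hg hl0 hc x le_rfl))
  have hsub : ∀ q : ℝ[X], q.degree < n → q.eval x = 1 → (q - p).degree < n ∧
      inner ℝ (polyVec A β p) (polyVec A β (q - p)) = 0 := by
    intro q hq hq1
    have hd : (q - p).degree < n := (degree_sub_le _ _).trans_lt (max_lt hq hpd)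
    refine ⟨hd, ?_⟩
    rw [polyVec_C_mul, inner_smul_left, inner_cgKernel hA hg hl0 hc x le_rfl hd, eval_sub, hq1,
      hp1, sub_self, mul_zero]
  have hmin : IsZeta lam b x (n - 1) p := by
    refine ⟨(hnd p).2 hpd, hp1, fun q hq hq1 => ?_⟩
    obtain ⟨h1, h2⟩ := hsub q ((hnd q).1 hq) hq1
    rw [polyNormSq_eq, polyNormSq_eq]
    exact (eq_of_norm_polyVec_le hg h1 h2).1
  have hspec : IsZeta lam b x (n - 1) (zeta lam b x (n - 1)) :=
    Classical.epsilon_spec ⟨p, hmin⟩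
  have h := hspec.2.2 p hmin.1 hp1
  obtain ⟨h1, h2⟩ := hsub _ ((hnd _).1 hspec.1) hspec.2.1
  rw [polyNormSq_eq, polyNormSq_eq] at h
  exact (eq_of_norm_polyVec_le hg h1 h2).2 h

theorem xi_eq (hg : GradeGE (diagOp lam) (WithLp.toLp 2 b) n) (hl0 : 0 < l)
    (hl : ∀ i, l ≤ lam i) (hn : 1 ≤ n) {x : ℝ} (hx : x < l) :
    xi lam b x (n - 1) =
      C ((cgKernel (diagOp lam) (WithLp.toLp 2 b) x n).eval 0)⁻¹ *
        cgKernel (diagOp lam) (WithLp.toLp 2 b) x n := by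
  have hκx := cgKernel_eval_pos (diagOp_isSymmetric lam) hg hl0 (le_inner_diagOp hl) hn hx hx
  rw [xi, zeta_eq hg hl0 hl hn hx, eval_mul, eval_C, ← mul_assoc, ← C_mul, mul_inv, inv_inv,
    mul_right_comm, mul_inv_cancel₀ hκx.ne', one_mul]

theorem degree_xi_lt (hg : GradeGE (diagOp lam) (WithLp.toLp 2 b) n) (hl0 : 0 < l)
    (hl : ∀ i, l ≤ lam i) (hn : 1 ≤ n) {x : ℝ} (hx : x < l) :
    (xi lam b x (n - 1)).degree < n := by
  rw [xi_eq hg hl0 hl hn hx, ← smul_eq_C_mul]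
  exact (degree_smul_le _ _).trans_lt
    (degree_cgKernel_lt (diagOp_isSymmetric lam) hg hl0 (le_inner_diagOp hl) x le_rfl)

/-- The inner products of the normalized kernel polynomial. -/
theorem inner_xi (hg : GradeGE (diagOp lam) (WithLp.toLp 2 b) n) (hl0 : 0 < l)
    (hl : ∀ i, l ≤ lam i) (hn : 1 ≤ n) {x : ℝ} (hx : x < l) {q : ℝ[X]} (hq : q.degree < n) :
    inner ℝ (polyVec (diagOp lam) (WithLp.toLp 2 b) (xi lam b x (n - 1)))
        (polyVec (diagOp lam) (WithLp.toLp 2 b) q) =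
      ((cgKernel (diagOp lam) (WithLp.toLp 2 b) x n).eval 0)⁻¹ * q.eval x := by
  rw [xi_eq hg hl0 hl hn hx, polyVec_C_mul, inner_smul_left,
    inner_cgKernel (diagOp_isSymmetric lam) hg hl0 (le_inner_diagOp hl) x le_rfl hq, conj_trivial]

/-- The squared norm of the kernel equals its value at `x`, so in the entries of `D` only the
normalization at `0` survives. -/
theorem polyNormSq_xi_div (hg : GradeGE (diagOp lam) (WithLp.toLp 2 b) n) (hl0 : 0 < l)
    (hl : ∀ i, l ≤ lam i) (hn : 1 ≤ n) {x : ℝ} (hx : x < l) :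
    polyNormSq lam b (xi lam b x (n - 1)) / (xi lam b x (n - 1)).eval x =
      ((cgKernel (diagOp lam) (WithLp.toLp 2 b) x n).eval 0)⁻¹ := by
  have hA := diagOp_isSymmetric lam
  have hc := le_inner_diagOp hl
  have hκx := cgKernel_eval_pos hA hg hl0 hc hn hx hx
  have hκ0 := cgKernel_eval_pos hA hg hl0 hc hn hx hl0
  rw [polyNormSq_eq, xi_eq hg hl0 hl hn hx, polyVec_C_mul, norm_smul, mul_pow,
    norm_polyVec_cgKernel_sq hA hg hl0 hc, eval_mul, eval_C, Real.norm_of_nonneg (by positivity)]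
  field_simp

end Diagonal

/-! ### The linear system for `σ`. -/

section Sigma

variable {d m : ℕ} {lam b : Fin (d + m) → ℝ} {n : ℕ} {l : ℝ}

theorem mulVec_matD_add (hg : GradeGE (diagOp (head lam)) (WithLp.toLp 2 (head b)) n)
    (hl0 : 0 < l) (hl : ∀ i, l ≤ head lam i) (hn : 1 ≤ n) (hgap : ∀ j, tail lam j < l)
    (x : Fin m → ℝ) (i : Fin m) :
    Matrix.mulVec (matD lam b n + matB b ^ 2 * matC lam b n) x i =
      ((cgKernel (diagOp (head lam)) (WithLp.toLp 2 (head b)) (tail lam i) n).eval 0)⁻¹ * x i +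
        tail b i ^ 2 *
          ∑ j, x j * (xi (head lam) (head b) (tail lam j) (n - 1)).eval (tail lam i) := by
  simp only [Matrix.add_mulVec, ← Matrix.mulVec_mulVec, Pi.add_apply,
    matD, matB, Matrix.diagonal_pow, Matrix.mulVec_diagonal,
    polyNormSq_xi_div hg hl0 hl hn (hgap _), Pi.pow_apply]
  congr 2
  simp only [matC, Matrix.mulVec, dotProduct, Matrix.of_apply]
  exact Finset.sum_congr rfl fun j _ => mul_comm _ _

/-- For `x` in the kernel of the matrix, put `f = ∑ x_j ξ^j`. The rows and the reproducing property
give `‖f‖² = -∑ b_j² f(λ_j)² ≤ 0`; hence `f = 0`, and the rows then force `x = 0`. -/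
theorem isUnit_matD_add (hg : GradeGE (diagOp (head lam)) (WithLp.toLp 2 (head b)) n)
    (hl0 : 0 < l) (hl : ∀ i, l ≤ head lam i) (hn : 1 ≤ n) (hgap : ∀ j, tail lam j < l) :
    IsUnit (matD lam b n + matB b ^ 2 * matC lam b n) := by
  rw [← Matrix.mulVec_injective_iff_isUnit, ← Matrix.coe_mulVecLin, ← LinearMap.ker_eq_bot,
    LinearMap.ker_eq_bot']
  intro x hx
  set ξ : Fin m → ℝ[X] := fun j => xi (head lam) (head b) (tail lam j) (n - 1)
  set κ0 : Fin m → ℝ := fun j =>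
    (cgKernel (diagOp (head lam)) (WithLp.toLp 2 (head b)) (tail lam j) n).eval 0
  have hκ0 : ∀ j, 0 < κ0 j := fun j => cgKernel_eval_pos (diagOp_isSymmetric _) hg hl0
    (le_inner_diagOp hl) hn (hgap j) hl0
  set f : ℝ[X] := ∑ j, C (x j) * ξ j
  have hf_eval : ∀ y, f.eval y = ∑ j, x j * (ξ j).eval y := fun y => by
    simp only [f, eval_finsetSum, eval_mul, eval_C]
  have hfd : f.degree < n := by
    rw [← mem_degreeLT]
    refine Submodule.sum_mem _ fun j _ => ?_
    rw [← smul_eq_C_mul]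
    exact Submodule.smul_mem _ _ (mem_degreeLT.2 (degree_xi_lt hg hl0 hl hn (hgap j)))
  have hrow : ∀ i, (κ0 i)⁻¹ * x i = - (tail b i ^ 2 * f.eval (tail lam i)) := by
    intro i
    have := congrFun hx i
    rw [Matrix.mulVecLin_apply, mulVec_matD_add hg hl0 hl hn hgap, ← hf_eval] at this
    exact eq_neg_of_add_eq_zero_left this
  have hf0 : f = 0 := by
    refine hg f hfd ?_
    rw [← inner_self_eq_zero (𝕜 := ℝ)]
    refine le_antisymm ?_ real_inner_self_nonneg
    calc _ = ∑ j, inner ℝ (polyVec (diagOp (head lam)) (WithLp.toLp 2 (head b)) (C (x j) * ξ j))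
          (polyVec (diagOp (head lam)) (WithLp.toLp 2 (head b)) f) := by
            rw [← sum_inner, ← map_sum]
      _ = ∑ j, - (tail b j * f.eval (tail lam j)) ^ 2 := by
        refine Finset.sum_congr rfl fun j _ => ?_
        rw [polyVec_C_mul, inner_smul_left, inner_xi hg hl0 hl hn (hgap j) hfd, conj_trivial]
        linear_combination f.eval (tail lam j) * hrow j
      _ ≤ 0 := Finset.sum_nonpos fun j _ => neg_nonpos.2 (sq_nonneg _)
  ext i
  have h := hrow i
  rw [hf0, eval_zero, mul_zero, neg_zero] at h
  exact (mul_eq_zero.1 h).resolve_left (inv_ne_zero (hκ0 i).ne')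

/-- The defining linear system of `σ`. -/
theorem sigma_spec (hg : GradeGE (diagOp (head lam)) (WithLp.toLp 2 (head b)) n)
    (hl0 : 0 < l) (hl : ∀ i, l ≤ head lam i) (hn : 1 ≤ n) (hgap : ∀ j, tail lam j < l)
    (i : Fin m) :
    ((cgKernel (diagOp (head lam)) (WithLp.toLp 2 (head b)) (tail lam i) n).eval 0)⁻¹ *
        sigma lam b n i + tail b i ^ 2 *
        ∑ j, sigma lam b n j * (xi (head lam) (head b) (tail lam j) (n - 1)).eval (tail lam i) =
      tail b i ^ 2 * (cgPoly (diagOp (head lam)) (WithLp.toLp 2 (head b)) n).r.eval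
        (tail lam i) := by
  have hu := (Matrix.isUnit_iff_isUnit_det _).1 (isUnit_matD_add (b := b) hg hl0 hl hn hgap)
  rw [← mulVec_matD_add hg hl0 hl hn hgap, sigma, Matrix.mulVec_mulVec,
    Matrix.mul_nonsing_inv _ hu, Matrix.one_mulVec, matB, Matrix.diagonal_pow,
    Matrix.mulVec_diagonal, vecW, varsigma_eq hg hl0 hl, Pi.pow_apply]

end Sigma

/-! ### Residual and iterate of the extended system. -/

section Extension

variable {d m : ℕ} {lam b : Fin (d + m) → ℝ} {n : ℕ} {l : ℝ}

theorem head_polyVec (lam b : Fin (d + m) → ℝ) (p : ℝ[X]) :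
    WithLp.toLp 2 (head (polyVec (diagOp lam) (WithLp.toLp 2 b) p).ofLp) =
      polyVec (diagOp (head lam)) (WithLp.toLp 2 (head b)) p := by
  ext i
  rw [polyVec_diagOp]
  exact polyVec_diagOp lam b p (Fin.castAdd m i)

theorem tail_polyVec (lam b : Fin (d + m) → ℝ) (p : ℝ[X]) (j : Fin m) :
    tail (polyVec (diagOp lam) (WithLp.toLp 2 b) p).ofLp j = p.eval (tail lam j) * tail b j :=
  polyVec_diagOp lam b p (Fin.natAdd d j)

theorem inner_polyVec_head_add_tail (lam b : Fin (d + m) → ℝ) (p q : ℝ[X]) :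
    inner ℝ (polyVec (diagOp lam) (WithLp.toLp 2 b) p)
        (polyVec (diagOp lam) (WithLp.toLp 2 b) q) =
      inner ℝ (polyVec (diagOp (head lam)) (WithLp.toLp 2 (head b)) p)
        (polyVec (diagOp (head lam)) (WithLp.toLp 2 (head b)) q) +
      ∑ j, tail b j ^ 2 * (p.eval (tail lam j) * q.eval (tail lam j)) := by
  rw [inner_polyVec_diagOp, inner_polyVec_diagOp, Fin.sum_univ_add]
  rfl

theorem GradeGE.of_head (hg : GradeGE (diagOp (head lam)) (WithLp.toLp 2 (head b)) n) :
    GradeGE (diagOp lam) (WithLp.toLp 2 b) n := by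
  intro p hp h0
  refine hg p hp ?_
  rw [← head_polyVec, h0]
  rfl

/-- The unnormalized residual polynomial of the extended system. -/
def extResidual (lam b : Fin (d + m) → ℝ) (n : ℕ) : ℝ[X] :=
  (cgPoly (diagOp (head lam)) (WithLp.toLp 2 (head b)) n).r -
    ∑ j, C (sigma lam b n j) * xi (head lam) (head b) (tail lam j) (n - 1)

/-- The polynomial which generates the iterate of the extended system. -/
def extIterate (lam b : Fin (d + m) → ℝ) (n : ℕ) : ℝ[X] :=
  C (1 - ∑ j, sigma lam b n j)⁻¹ *
    ((cgPoly (diagOp (head lam)) (WithLp.toLp 2 (head b)) n).v -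
      ∑ j, C (sigma lam b n j) *
        cgKernelIterate (diagOp (head lam)) (WithLp.toLp 2 (head b)) (tail lam j) n)

theorem extResidual_eval (x : ℝ) :
    (extResidual lam b n).eval x =
      (cgPoly (diagOp (head lam)) (WithLp.toLp 2 (head b)) n).r.eval x -
        ∑ j, sigma lam b n j * (xi (head lam) (head b) (tail lam j) (n - 1)).eval x := by
  simp only [extResidual, eval_sub, eval_finsetSum, eval_mul, eval_C]

theorem sigmaNorm_nonneg (lam b : Fin (d + m) → ℝ) (n : ℕ) : 0 ≤ sigmaNorm lam b n :=
  Finset.sum_nonneg fun _ _ => abs_nonneg _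

theorem sum_sigma_le (lam b : Fin (d + m) → ℝ) (n : ℕ) :
    ∑ j, sigma lam b n j ≤ sigmaNorm lam b n :=
  Finset.sum_le_sum fun _ _ => le_abs_self _

theorem degree_extResidual (hg : GradeGE (diagOp (head lam)) (WithLp.toLp 2 (head b)) n)
    (hl0 : 0 < l) (hl : ∀ i, l ≤ head lam i) (hn : 1 ≤ n) (hgap : ∀ j, tail lam j < l) :
    (extResidual lam b n).degree = n := by
  have hd := (cgInvariant (diagOp_isSymmetric _) hg
    (inner_pos_of_coercive hl0 (le_inner_diagOp hl)) le_rfl).degree_r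
  rw [extResidual, degree_sub_eq_left_of_degree_lt, hd]
  rw [hd, ← mem_degreeLT]
  refine Submodule.sum_mem _ fun j _ => ?_
  rw [← smul_eq_C_mul]
  exact Submodule.smul_mem _ _ (mem_degreeLT.2 (degree_xi_lt hg hl0 hl hn (hgap j)))

/-- In the head, `rₙ` drops out and each `ξ^j` reproduces a multiple of `q(λ_j)`. The coefficient of
`q(λ_j)` then cancels against the tail by the `j`th equation for `σ`. -/
theorem extResidual_orth (hg : GradeGE (diagOp (head lam)) (WithLp.toLp 2 (head b)) n)
    (hl0 : 0 < l) (hl : ∀ i, l ≤ head lam i) (hn : 1 ≤ n) (hgap : ∀ j, tail lam j < l)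
    {q : ℝ[X]} (hq : q.degree < n) :
    inner ℝ (polyVec (diagOp lam) (WithLp.toLp 2 b) (extResidual lam b n))
      (polyVec (diagOp lam) (WithLp.toLp 2 b) q) = 0 := by
  rw [inner_polyVec_head_add_tail, extResidual, map_sub, map_sum, inner_sub_left, sum_inner,
    polyVec_cgPoly_r_orth (diagOp_isSymmetric _) hg hl0 (le_inner_diagOp hl) le_rfl hq, zero_sub,
    neg_add_eq_zero, ← extResidual]
  refine Finset.sum_congr rfl fun j _ => ?_
  rw [polyVec_C_mul, inner_smul_left, inner_xi hg hl0 hl hn (hgap j) hq, conj_trivial,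
    extResidual_eval]
  linear_combination q.eval (tail lam j) * sigma_spec hg hl0 hl hn hgap j

theorem extResidual_eval_pos (hg : GradeGE (diagOp (head lam)) (WithLp.toLp 2 (head b)) n)
    (hl0 : 0 < l) (hl : ∀ i, l ≤ head lam i) (hn : 1 ≤ n) (hgap : ∀ j, tail lam j < l)
    (hsigma : sigmaNorm lam b n < 1) {x : ℝ} (hx : x ≤ 0) :
    0 < (extResidual lam b n).eval x := by
  have hA := diagOp_isSymmetric (head lam)
  have hc := le_inner_diagOp hl
  set ρ := (cgPoly (diagOp (head lam)) (WithLp.toLp 2 (head b)) n).r with hρ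
  have hpos : 0 < ρ.eval x := cgPoly_r_eval_pos hA hg hl0 hc le_rfl (hx.trans_lt hl0)
  rw [extResidual_eval, ← hρ]
  have hle : ∑ j, sigma lam b n j * (xi (head lam) (head b) (tail lam j) (n - 1)).eval x ≤
      sigmaNorm lam b n * ρ.eval x := by
    rw [sigmaNorm, Finset.sum_mul]
    refine Finset.sum_le_sum fun j _ => (le_abs_self _).trans ?_
    rw [abs_mul, xi_eq hg hl0 hl hn (hgap j)]
    exact mul_le_mul_of_nonneg_left (abs_normalized_cgKernel_eval_le hA hg hl0 hc hn (hgap j) hx)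
      (abs_nonneg _)
  nlinarith

theorem ext_inner_pos (hg : GradeGE (diagOp (head lam)) (WithLp.toLp 2 (head b)) n)
    (hl0 : 0 < l) (hl : ∀ i, l ≤ head lam i) (hn : 1 ≤ n) (hgap : ∀ j, tail lam j < l)
    (hsigma : sigmaNorm lam b n < 1) :
    ∀ x ∈ krylov (diagOp lam) (WithLp.toLp 2 b) n, x ≠ 0 → 0 < inner ℝ x (diagOp lam x) :=
  inner_pos_of_no_root (diagOp_isSymmetric lam) hg.of_head
    (degree_extResidual hg hl0 hl hn hgap) (fun _ hq => extResidual_orth hg hl0 hl hn hgap hq)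
    fun _ hθ => (extResidual_eval_pos hg hl0 hl hn hgap hsigma hθ).ne'

/-- Since `ξ^j = 1 - X h_j`, the unnormalized residual has value `1 - ∑ σ_j` at `0`, nonzero because
`‖σ‖₁ < 1`. -/
theorem one_sub_X_mul_extIterate
    (hg : GradeGE (diagOp (head lam)) (WithLp.toLp 2 (head b)) n)
    (hl0 : 0 < l) (hl : ∀ i, l ≤ head lam i) (hn : 1 ≤ n) (hgap : ∀ j, tail lam j < l)
    (hsigma : sigmaNorm lam b n < 1) :
    1 - X * extIterate lam b n =
      C (1 - ∑ j, sigma lam b n j)⁻¹ * extResidual lam b n := by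
  have hs : 1 - ∑ j, sigma lam b n j ≠ 0 := by
    have := sum_sigma_le lam b n
    linarith
  have hxi : ∀ j, xi (head lam) (head b) (tail lam j) (n - 1) = 1 - X *
      cgKernelIterate (diagOp (head lam)) (WithLp.toLp 2 (head b)) (tail lam j) n := fun j => by
    rw [xi_eq hg hl0 hl hn (hgap j), normalized_cgKernel_eq (diagOp_isSymmetric _) hg hl0
      (le_inner_diagOp hl) hn (hgap j)]
  have h1 : (1 : ℝ[X]) = C (1 - ∑ j, sigma lam b n j)⁻¹ * (1 - ∑ j, C (sigma lam b n j)) := by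
    rw [← map_sum, ← C_1, ← C_sub, ← C_mul, inv_mul_cancel₀ hs]
  have h2 : ∑ j, C (sigma lam b n j) * xi (head lam) (head b) (tail lam j) (n - 1) =
      ∑ j, C (sigma lam b n j) - X * ∑ j, C (sigma lam b n j) *
        cgKernelIterate (diagOp (head lam)) (WithLp.toLp 2 (head b)) (tail lam j) n := by
    rw [Finset.mul_sum, ← Finset.sum_sub_distrib]
    refine Finset.sum_congr rfl fun j _ => ?_
    rw [hxi]
    ring
  rw [extIterate, extResidual, h2, cgPoly_r_eq]
  linear_combination h1

theorem degree_extIterate_lt (hg : GradeGE (diagOp (head lam)) (WithLp.toLp 2 (head b)) n)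
    (hl0 : 0 < l) (hl : ∀ i, l ≤ head lam i) : (extIterate lam b n).degree < n := by
  have hA := diagOp_isSymmetric (head lam)
  have hc := le_inner_diagOp hl
  rw [← mem_degreeLT, extIterate, ← smul_eq_C_mul]
  refine Submodule.smul_mem _ _ (Submodule.sub_mem _ (mem_degreeLT.2
    (cgInvariant hA hg (inner_pos_of_coercive hl0 hc) le_rfl).degree_v)
    (Submodule.sum_mem _ fun j _ => ?_))
  rw [← smul_eq_C_mul]
  exact Submodule.smul_mem _ _ (mem_degreeLT.2 (degree_cgKernelIterate_lt hA hg hl0 hc _))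

theorem cgIterate_ext (hg : GradeGE (diagOp (head lam)) (WithLp.toLp 2 (head b)) n)
    (hl0 : 0 < l) (hl : ∀ i, l ≤ head lam i) (hn : 1 ≤ n) (hgap : ∀ j, tail lam j < l)
    (hsigma : sigmaNorm lam b n < 1) :
    cgIterate (diagOp lam) (WithLp.toLp 2 b) n =
      polyVec (diagOp lam) (WithLp.toLp 2 b) (extIterate lam b n) := by
  refine cgIterate_eq_polyVec (diagOp_isSymmetric lam) hg.of_head
    (ext_inner_pos hg hl0 hl hn hgap hsigma) (degree_extIterate_lt hg hl0 hl) fun p hp => ?_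
  rw [one_sub_X_mul_extIterate hg hl0 hl hn hgap hsigma, polyVec_C_mul, inner_smul_left,
    extResidual_orth hg hl0 hl hn hgap hp, mul_zero]

theorem extIterate_sub_eq (hsigma : sigmaNorm lam b n < 1) :
    extIterate lam b n - (cgPoly (diagOp (head lam)) (WithLp.toLp 2 (head b)) n).v =
      C (1 - ∑ j, sigma lam b n j)⁻¹ * ∑ j, C (sigma lam b n j) *
        ((cgPoly (diagOp (head lam)) (WithLp.toLp 2 (head b)) n).v -
          cgKernelIterate (diagOp (head lam)) (WithLp.toLp 2 (head b)) (tail lam j) n) := by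
  have hs : 1 - ∑ j, sigma lam b n j ≠ 0 := by
    have := sum_sigma_le lam b n
    linarith
  have h1 : (1 : ℝ[X]) = C (1 - ∑ j, sigma lam b n j)⁻¹ * (1 - ∑ j, C (sigma lam b n j)) := by
    rw [← map_sum, ← C_1, ← C_sub, ← C_mul, inv_mul_cancel₀ hs]
  simp only [mul_sub, Finset.sum_sub_distrib, ← Finset.sum_mul]
  rw [extIterate]
  linear_combination
    (-(cgPoly (diagOp (head lam)) (WithLp.toLp 2 (head b)) n).v) * h1

/-- Stated for a general normed space to serve both the head, with vectors, and the tail, with real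
values of polynomials. -/
theorem norm_inv_sum_smul_le {F : Type*} [NormedAddCommGroup F] [NormedSpace ℝ F]
    (hsigma : sigmaNorm lam b n < 1) {x : Fin m → F} {c : ℝ} (hx : ∀ j, ‖x j‖ ≤ c) :
    ‖(1 - ∑ j, sigma lam b n j)⁻¹ • ∑ j, sigma lam b n j • x j‖ ≤
      sigmaNorm lam b n / (1 - sigmaNorm lam b n) * c := by
  have hs := sum_sigma_le lam b n
  have h0 := sigmaNorm_nonneg lam b n
  have hsum : ‖∑ j, sigma lam b n j • x j‖ ≤ sigmaNorm lam b n * c := by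
    rw [sigmaNorm, Finset.sum_mul]
    refine (norm_sum_le _ _).trans (Finset.sum_le_sum fun j _ => ?_)
    rw [norm_smul, Real.norm_eq_abs]
    exact mul_le_mul_of_nonneg_left (hx j) (abs_nonneg _)
  have hinv : (1 - ∑ j, sigma lam b n j)⁻¹ ≤ (1 - sigmaNorm lam b n)⁻¹ :=
    inv_anti₀ (by linarith) (by linarith)
  have hinv0 : 0 ≤ (1 - ∑ j, sigma lam b n j)⁻¹ := inv_nonneg.2 (by linarith)
  rw [norm_smul, Real.norm_of_nonneg hinv0, div_mul_eq_mul_div, div_eq_inv_mul]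
  exact mul_le_mul hinv hsum (norm_nonneg _) (inv_nonneg.2 (by linarith))

end Extension

end CGIndef

end

theorem theorem3p9 {d m : ℕ} (hd : 0 < d) (lam b : Fin (d + m) → ℝ)
    (hanti : Antitone lam)
    (lamd : ℝ) (hlamd : lamd = CGIndef.head lam ⟨d - 1, Nat.sub_lt hd Nat.one_pos⟩)
    (hpos : 0 < lamd)
    (hgap : ∀ j : Fin m, CGIndef.tail lam j < lamd)
    (n : ℕ) (hn1 : 1 ≤ n)
    (hn : n ≤ CGIndef.grade (CGIndef.diagOp (CGIndef.head lam))
      (WithLp.toLp 2 (CGIndef.head b)))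
    (hsigma : CGIndef.sigmaNorm lam b n < 1)
    (v : EuclideanSpace ℝ (Fin d))
    (hv : v = CGIndef.cgIterate (CGIndef.diagOp (CGIndef.head lam))
      (WithLp.toLp 2 (CGIndef.head b)) n)
    (v' : EuclideanSpace ℝ (Fin (d + m)))
    (hv' : v' = CGIndef.cgIterate (CGIndef.diagOp lam) (WithLp.toLp 2 b) n) :
    CGIndef.CGWellDefined (CGIndef.diagOp (CGIndef.head lam))
        (WithLp.toLp 2 (CGIndef.head b)) n ∧
      CGIndef.CGWellDefined (CGIndef.diagOp lam) (WithLp.toLp 2 b) n ∧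
      ‖WithLp.toLp 2 (CGIndef.head v'.ofLp) - v‖ ≤
        CGIndef.sigmaNorm lam b n / (1 - CGIndef.sigmaNorm lam b n) * ‖v‖ ∧
      ∀ j : Fin m, |CGIndef.tail v'.ofLp j| ≤
        |CGIndef.tail b j| / (1 - CGIndef.sigmaNorm lam b n) *
          CGIndef.tailBound lamd (CGIndef.tail lam j) n := by
  open CGIndef in
  have hl : ∀ i, lamd ≤ head lam i := by
    intro i
    rw [hlamd]
    refine hanti ?_
    rw [Fin.le_def]
    simp only [Fin.val_castAdd]
    omega
  have hg : GradeGE (diagOp (head lam)) (WithLp.toLp 2 (head b)) n := (le_grade_iff _ _ _).1 hn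
  have hA := diagOp_isSymmetric (head lam)
  have hc := le_inner_diagOp hl
  have h0 := sigmaNorm_nonneg lam b n
  have hext := cgIterate_ext hg hpos hl hn1 hgap hsigma
  have hvp : v = polyVec (diagOp (head lam)) (WithLp.toLp 2 (head b))
      (cgPoly (diagOp (head lam)) (WithLp.toLp 2 (head b)) n).v := by
    rw [hv, polyVec_cgPoly_v]; rfl
  refine ⟨⟨hn, inner_pos_of_coercive hpos hc⟩, ⟨(le_grade_iff _ _ _).2 hg.of_head,
    ext_inner_pos hg hpos hl hn1 hgap hsigma⟩, ?_, fun j => ?_⟩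
  · rw [hv', hext, head_polyVec, hvp, ← map_sub, extIterate_sub_eq hsigma, polyVec_C_mul, map_sum,
      ← hvp]
    simp only [polyVec_C_mul]
    refine norm_inv_sum_smul_le hsigma fun i => ?_
    rw [hv]
    exact norm_sub_cgKernelIterate_le hA hg hpos hc hn1 (hgap i)
  · rw [hv', hext, tail_polyVec, abs_mul]
    set κ := (cgPoly (diagOp (head lam)) (WithLp.toLp 2 (head b)) n).v
    set x := tail lam j
    have hκ0 : 0 ≤ κ.eval x := cgPoly_v_eval_nonneg hA hg hpos hc le_rfl (hgap j)
    have hκ1 : κ.eval x ≤ tailBound lamd x n := cgPoly_v_eval_le_tailBound hA hg hpos hc (hgap j)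
    have hdiff : |(extIterate lam b n - κ).eval x| ≤
        sigmaNorm lam b n / (1 - sigmaNorm lam b n) * κ.eval x := by
      rw [extIterate_sub_eq hsigma, ← Real.norm_eq_abs]
      simp only [eval_mul, eval_finsetSum, eval_C]
      refine norm_inv_sum_smul_le (F := ℝ) hsigma fun i => ?_
      have h := eval_sub_cgKernelIterate_mem_Icc hA hg hpos hc hn1 (hgap i) (hgap j)
      rw [Real.norm_of_nonneg h.1]
      exact h.2
    -- Triangle inequality through `vₙ(λ_j) ≥ 0`, with `1 + s/(1 - s) = 1/(1 - s)` for `s = ‖σ‖₁`.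
    have hle : |(extIterate lam b n).eval x| ≤ κ.eval x / (1 - sigmaNorm lam b n) := by
      have h1 : |(extIterate lam b n).eval x| ≤ κ.eval x + |(extIterate lam b n - κ).eval x| := by
        rw [eval_sub]
        have := abs_add_le (κ.eval x) ((extIterate lam b n).eval x - κ.eval x)
        rwa [add_sub_cancel, abs_of_nonneg hκ0] at this
      refine (h1.trans (add_le_add_right hdiff _)).trans_eq ?_
      have : 1 - sigmaNorm lam b n ≠ 0 := by linarith
      field_simp
      ring
    calc _ ≤ tailBound lamd x n / (1 - sigmaNorm lam b n) * |tail b j| :=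
          mul_le_mul_of_nonneg_right
            (hle.trans (div_le_div_of_nonneg_right hκ1 (by linarith))) (abs_nonneg _)
      _ = _ := by ring
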